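/- **Notation.** Let $\mathcal N\ge 2$ and $\alpha,\beta\in\{0,\dots,\mathcal N-1\}$ be integers and $p_1,p_2\in\mathbb C$. Lattice functions $f_{n,m}^{(r)}$ depend on $n,m,r\in\mathbb Z$; "periodic" means $f_{n,m}^{(r+\mathcal N)}=f_{n,m}^{(r)}$. Consider the systems (for all $n,m,r$; denominators are required not to vanish) for periodic functions $u$, $v$: $$\frac{p_1+u_{n,m+1}^{(r+1+\alpha)}-u_{n+1,m+1}^{(r)}}{p_1+u_{n,m}^{(r+1+\alpha+\beta)}-u_{n+1,m}^{(r+\beta)}}=\frac{p_2+u_{n+1,m}^{(r+1+\beta)}-u_{n+1,m+1}^{(r)}}{p_2+u_{n,m}^{(r+1+\alpha+\beta)}-u_{n,m+1}^{(r+\alpha)}},\tag{U}$$ $$p_1\left(\frac{v_{n+1,m+1}^{(r)}}{v_{n,m+1}^{(r+\alpha)}}-\frac{v_{n+1,m}^{(r+1+\beta)}}{v_{n,m}^{(r+1+\alpha+\beta)}}\right)=p_2\left(\frac{v_{n+1,m+1}^{(r)}}{v_{n+1,m}^{(r+\beta)}}-\frac{v_{n,m+1}^{(r+1+\alpha)}}{v_{n,m}^{(r+1+\alpha+\beta)}}\right),\tag{V}$$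 and the bilinear system for periodic $\tau$: $$p_1\left(\tau_{n,m}^{(r+1+\alpha+\beta)}\tau_{n+1,m+1}^{(r)}-\tau_{n,m+1}^{(r+\alpha)}\tau_{n+1,m}^{(r+1+\beta)}\right)=p_2\left(\tau_{n,m}^{(r+1+\alpha+\beta)}\tau_{n+1,m+1}^{(r)}-\tau_{n+1,m}^{(r+\beta)}\tau_{n,m+1}^{(r+1+\alpha)}\right).\tag{B}$$ **Theorem, part 1 (common bilinear form).** Let $p_1,p_2\neq0$. Consider the transformations $v_{n,m}^{(r)}=\tau_{n,m}^{(r+1)}/\tau_{n,m}^{(r)}$ and $$p_1+u_{n,m}^{(r+1+\alpha)}-u_{n+1,m}^{(r)}=p_1\frac{\tau_{n,m}^{(r+\alpha)}\tau_{n+1,m}^{(r+1)}}{\tau_{n,m}^{(r+1+\alpha)}\tau_{n+1,m}^{(r)}},\qquad p_2+u_{n,m}^{(r+1+\beta)}-u_{n,m+1}^{(r)}=p_2\frac{\tau_{n,m}^{(r+\beta)}\tau_{n,m+1}^{(r+1)}}{\tau_{n,m}^{(r+1+\beta)}\tau_{n,m+1}^{(r)}},$$ $$p_1-p_2+u_{n,m+1}^{(r+\alpha)}-u_{n+1,m}^{(r+\beta)}=(p_1-p_2)\frac{\tau_{n,m}^{(r+\alpha+\beta)}\tau_{n+1,m+1}^{(r)}}{\tau_{n,m+1}^{(r+\alpha)}\tau_{n+1,m}^{(r+\beta)}}.\tag{T}$$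 (a) Let $\tau$ be periodic and nowhere zero. Then $\tau$ solves (B) if and only if there is a periodic $u$ with (T); every periodic $u$ with (T) solves (U). If $\tau$ solves (B), then $v=\tau^{(r+1)}/\tau^{(r)}$ solves (V). (b) Conversely let $p_1\ne p_2$. Every solution $u$ of (U) with $\prod_{r=0}^{\mathcal N-1}(p_1+u_{n,m}^{(r+1+\alpha)}-u_{n+1,m}^{(r)})=p_1^{\mathcal N}$, $\prod_{r=0}^{\mathcal N-1}(p_2+u_{n,m}^{(r+1+\beta)}-u_{n,m+1}^{(r)})=p_2^{\mathcal N}$ and $p_1-p_2+u_{n,m+1}^{(r+\alpha)}-u_{n+1,m}^{(r+\beta)}\neq0$ everywhere satisfies (T) for some nowhere zero solution $\tau$ of (B); every nowhere zero solution $v$ of (V) with $\prod_{r=0}^{\mathcal N-1}v_{n,m}^{(r)}=1$ and $p_1v_{n+1,m}^{(r+\beta)}\ne p_2v_{n,m+1}^{(r+\alpha)}$ everywhere is $\tau^{(r+1)}/\tau^{(r)}$ for some nowhere zero solution $\tau$ of (B). **Theorem, part 2 (solution).** Let $\omega=e^{2\pi\mathrm i/\mathcal N}$ and $J=\{0<j<\mathcal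 N:\gcd(j,\mathcal N)=1\}$. For $j\in J$ let $\Gamma_j\subset\mathbb C$ be a measurable set (contour) and $d\lambda_j=w_j\,d\mu_j$ with a $\sigma$-finite positive measure $\mu_j$ and a measurable complex density $w_j$. Let $$\rho_{n,m}^{(r)}(k)=(k^\alpha(p_1+k))^n(k^\beta(p_2+k))^mk^r,\qquad \sigma_{n,m}^{(r)}(k')=(k'^\alpha(p_1+k'))^{-n}(k'^\beta(p_2+k'))^{-m}k'^{-r}.$$ Assume that $k$, $p_i+k$, $p_i+\omega^jk$ ($i=1,2$) do not vanish for $k\in\Gamma_j$ and that $l\ne\omega^jk$ for $k\in\Gamma_j$, $l\in\Gamma_{j'}$, $j,j'\in J$. With matrices indexed by $\mathbb Z\times\mathbb Z$ put $\Lambda(a,b)=\delta_{a+1,b}$, ${}^t\Lambda(a,b)=\delta_{a,b+1}$, $O(a,b)=\delta_{a,0}\delta_{0,b}$, $\Omega=\sum_{i\ge0}{}^t\Lambda^iO\Lambda^{-i-1}$, $\mathbf c(k)=(k^a)_{a\in\mathbb Z}$ (column), ${}^t\mathbf c(k)$ the corresponding row, and $$C_{n,m}^{(r)}=\sum_{j\in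 J}\int_{\Gamma_j}d\lambda_j(k)\,\rho_{n,m}^{(r)}(k)\,\mathbf c(k)\,{}^t\mathbf c(\omega^jk)\,\sigma_{n,m}^{(r)}(\omega^jk).$$ Here $\operatorname{tr}(\Omega C)^{i+1}$ is the sum over $j_0,\dots,j_i\in J$ of the $(i+1)$-fold integrals of the traces of the products of the integrands; the geometric series in these matrix products and traces, ${}^t\mathbf c(k')\,\Omega\,\mathbf c(k)=\sum_{a\ge0}k'^ak^{-a-1}$, are summed to $1/(k-k')$ for all $k\ne k'$ (analytic continuation). Assume that these integrals converge absolutely. Then $$\tau_{n,m}^{(r)}=\det(1+\Omega C_{n,m}^{(r)})=\sum_{i'=0}^\infty\frac1{i'!}\left(\sum_{i=0}^\infty\frac{(-1)^i}{i+1}\operatorname{tr}\bigl(\Omega C_{n,m}^{(r)}\bigr)^{i+1}\right)^{i'}$$ is periodic and solves (B): order by order, i.e. as an identity of formal power series in $\varepsilon$ after all $d\lambda_j$ are replaced by $\varepsilon\,d\lambda_j$; and as an identity of complex numbers at all $(n,m,r)$ for which the inner series converges at the six lattice points that occur in (B). -/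

import Mathlib

open MeasureTheory Filter Topology
open scoped PowerSeries

noncomputable section

namespace FX

/-! ### Lattice functions and the difference systems

A lattice function is written `f n m r`, for the value with lower indices `n`, `m` and upper
index `r`. -/

/-- The condition that `f` has period `N` in the upper index. -/
def IsPeriodic {R : Type*} (N : ℕ) (f : ℤ → ℤ → ℤ → R) : Prop :=
  ∀ n m r, f n m (r + N) = f n m r

/-- The system for the additive potential `u` (with nonvanishing denominators). -/
def USystem (N α β : ℕ) (p₁ p₂ : ℂ) (u : ℤ → ℤ → ℤ → ℂ) : Prop :=
  IsPeriodic N u ∧ ∀ n m r : ℤ,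
    p₁ + u n m (r + 1 + α + β) - u (n + 1) m (r + β) ≠ 0 ∧
    p₂ + u n m (r + 1 + α + β) - u n (m + 1) (r + α) ≠ 0 ∧
    (p₁ + u n (m + 1) (r + 1 + α) - u (n + 1) (m + 1) r) /
        (p₁ + u n m (r + 1 + α + β) - u (n + 1) m (r + β)) =
      (p₂ + u (n + 1) m (r + 1 + β) - u (n + 1) (m + 1) r) /
        (p₂ + u n m (r + 1 + α + β) - u n (m + 1) (r + α))

/-- The system for the quotient potential `v` (with nonvanishing denominators). -/
def VSystem (N α β : ℕ) (p₁ p₂ : ℂ) (v : ℤ → ℤ → ℤ → ℂ) : Prop :=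
  IsPeriodic N v ∧ (∀ n m r : ℤ, v n m r ≠ 0) ∧ ∀ n m r : ℤ,
    p₁ * (v (n + 1) (m + 1) r / v n (m + 1) (r + α)
        - v (n + 1) m (r + 1 + β) / v n m (r + 1 + α + β)) =
      p₂ * (v (n + 1) (m + 1) r / v (n + 1) m (r + β)
        - v n (m + 1) (r + 1 + α) / v n m (r + 1 + α + β))

/-- The bilinear equation at one lattice point, with values in a commutative `ℂ`-algebra. -/
def BilinearAt {R : Type*} [CommRing R] [Algebra ℂ R] (α β : ℕ) (p₁ p₂ : ℂ)
    (τ : ℤ → ℤ → ℤ → R) (n m r : ℤ) : Prop :=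
  p₁ • (τ n m (r + 1 + α + β) * τ (n + 1) (m + 1) r
      - τ n (m + 1) (r + α) * τ (n + 1) m (r + 1 + β)) =
    p₂ • (τ n m (r + 1 + α + β) * τ (n + 1) (m + 1) r
      - τ (n + 1) m (r + β) * τ n (m + 1) (r + 1 + α))

/-- The `N`-periodic bilinear system. -/
def BilinearSystem {R : Type*} [CommRing R] [Algebra ℂ R] (N α β : ℕ) (p₁ p₂ : ℂ)
    (τ : ℤ → ℤ → ℤ → R) : Prop :=
  IsPeriodic N τ ∧ ∀ n m r : ℤ, BilinearAt α β p₁ p₂ τ n m r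

/-- The dependent variable transformation between `v` and `τ`. -/
def VTransform (v τ : ℤ → ℤ → ℤ → ℂ) : Prop :=
  ∀ n m r : ℤ, v n m r = τ n m (r + 1) / τ n m r

/-- The dependent variable transformation between `u` and `τ`. -/
def UTransform (α β : ℕ) (p₁ p₂ : ℂ) (u τ : ℤ → ℤ → ℤ → ℂ) : Prop :=
  ∀ n m r : ℤ,
    p₁ + u n m (r + 1 + α) - u (n + 1) m r =
      p₁ * (τ n m (r + α) * τ (n + 1) m (r + 1) / (τ n m (r + 1 + α) * τ (n + 1) m r)) ∧
    p₂ + u n m (r + 1 + β) - u n (m + 1) r =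
      p₂ * (τ n m (r + β) * τ n (m + 1) (r + 1) / (τ n m (r + 1 + β) * τ n (m + 1) r)) ∧
    p₁ - p₂ + u n (m + 1) (r + α) - u (n + 1) m (r + β) =
      (p₁ - p₂) * (τ n m (r + α + β) * τ (n + 1) (m + 1) r /
        (τ n (m + 1) (r + α) * τ (n + 1) m (r + β)))

/-- The system for `u` has the bilinear system as its bilinear form: nowhere vanishing periodic
solutions `τ` are those functions that come with a periodic `u` through the transformation; such a
`u` solves the system; and all generic solutions `u` which obey the first integrals
(necessary if `τ` is periodic) are obtained. -/
def UHasBilinearForm (N α β : ℕ) (p₁ p₂ : ℂ) : Prop :=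
  (∀ τ : ℤ → ℤ → ℤ → ℂ, (∀ n m r, τ n m r ≠ 0) → IsPeriodic N τ →
    (BilinearSystem N α β p₁ p₂ τ ↔ ∃ u, IsPeriodic N u ∧ UTransform α β p₁ p₂ u τ) ∧
    ∀ u, IsPeriodic N u → UTransform α β p₁ p₂ u τ → USystem N α β p₁ p₂ u) ∧
  (p₁ ≠ p₂ → ∀ u, USystem N α β p₁ p₂ u →
    (∀ n m : ℤ, ∏ r ∈ Finset.range N, (p₁ + u n m (r + 1 + α) - u (n + 1) m r) = p₁ ^ N) →
    (∀ n m : ℤ, ∏ r ∈ Finset.range N, (p₂ + u n m (r + 1 + β) - u n (m + 1) r) = p₂ ^ N) →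
    (∀ n m r : ℤ, p₁ - p₂ + u n (m + 1) (r + α) - u (n + 1) m (r + β) ≠ 0) →
    ∃ τ : ℤ → ℤ → ℤ → ℂ, (∀ n m r, τ n m r ≠ 0) ∧
      BilinearSystem N α β p₁ p₂ τ ∧ UTransform α β p₁ p₂ u τ)

/-- The system for `v` has the bilinear system as its bilinear form: nowhere vanishing periodic
solutions `τ` give solutions `v`, and all generic solutions `v` which obey the first integral
(necessary if `τ` is periodic) are obtained. -/
def VHasBilinearForm (N α β : ℕ) (p₁ p₂ : ℂ) : Prop :=
  (∀ τ v : ℤ → ℤ → ℤ → ℂ, (∀ n m r, τ n m r ≠ 0) → BilinearSystem N α β p₁ p₂ τ →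
    VTransform v τ → VSystem N α β p₁ p₂ v) ∧
  (p₁ ≠ p₂ → ∀ v, VSystem N α β p₁ p₂ v →
    (∀ n m : ℤ, ∏ r ∈ Finset.range N, v n m r = 1) →
    (∀ n m r : ℤ, p₁ * v (n + 1) m (r + β) ≠ p₂ * v n (m + 1) (r + α)) →
    ∃ τ : ℤ → ℤ → ℤ → ℂ, (∀ n m r, τ n m r ≠ 0) ∧
      BilinearSystem N α β p₁ p₂ τ ∧ VTransform v τ)

/-! ### Infinite matrices

The geometric series `∑ k' ^ i * k ^ (-i - 1)` that occur in products and traces of the infinite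
matrices below are summed to `1 / (k - k')` for all `k ≠ k'`, that is by analytic continuation
(here `|k'| = |k|` may happen, and does in every trace). -/

/-- `∑ f i = S` in the sense of analytic continuation: the generating function `∑ f i * X ^ i` is
(the expansion of) a rational function which is regular at `1` and has the value `S` there. -/
def HasRegSum (f : ℕ → ℂ) (S : ℂ) : Prop :=
  ∃ P Q : Polynomial ℂ, Q.eval 1 ≠ 0 ∧
    (Q : ℂ⟦X⟧) * PowerSeries.mk f = (P : ℂ⟦X⟧) ∧ S = P.eval 1 / Q.eval 1

theorem HasRegSum.unique {f : ℕ → ℂ} {S T : ℂ} (hS : HasRegSum f S) (hT : HasRegSum f T) :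
    S = T := by
  obtain ⟨P, Q, hQ, h, rfl⟩ := hS
  obtain ⟨P', Q', hQ', h', rfl⟩ := hT
  have e : P * Q' = P' * Q := by
    apply Polynomial.coe_injective (R := ℂ)
    rw [Polynomial.coe_mul, Polynomial.coe_mul, ← h, ← h']
    ring
  have e1 := congrArg (Polynomial.eval 1) e
  simp only [Polynomial.eval_mul] at e1
  rw [div_eq_div_iff hQ hQ', e1]

open Classical in
/-- The sum of a series in the sense of `HasRegSum` (`0` if there is none). -/
def regSum (f : ℕ → ℂ) : ℂ := if h : ∃ S, HasRegSum f S then h.choose else 0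

theorem HasRegSum.regSum_eq {f : ℕ → ℂ} {S : ℂ} (h : HasRegSum f S) : regSum f = S := by
  have h' : ∃ S, HasRegSum f S := ⟨S, h⟩
  rw [regSum, dif_pos h']
  exact h'.choose_spec.unique h

/-- Finite sums are summed as usual. -/
theorem hasRegSum_of_finite {f : ℕ → ℂ} {d : ℕ} (hf : ∀ i, d ≤ i → f i = 0) :
    HasRegSum f (∑ i ∈ Finset.range d, f i) := by
  refine ⟨∑ i ∈ Finset.range d, Polynomial.C (f i) * Polynomial.X ^ i, 1, by simp, ?_, ?_⟩
  · ext a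
    simp only [Polynomial.coe_one, one_mul, PowerSeries.coeff_mk, Polynomial.coeff_coe,
      Polynomial.finsetSum_coeff, Polynomial.coeff_C_mul_X_pow]
    rw [Finset.sum_ite_eq]
    split_ifs with h
    · rfl
    · exact hf a (by simpa using h)
  · simp [Polynomial.eval_finsetSum]

/-- The geometric series. -/
theorem hasRegSum_geometric (A q : ℂ) (hq : q ≠ 1) :
    HasRegSum (fun i => A * q ^ i) (A / (1 - q)) := by
  refine ⟨Polynomial.C A, 1 - Polynomial.C q * Polynomial.X, ?_, ?_, by simp⟩
  · simpa [sub_eq_zero] using hq.symm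
  · ext a
    cases a with
    | zero => simp [sub_mul]
    | succ a =>
      simp [sub_mul, mul_assoc, PowerSeries.coeff_succ_X_mul]
      ring

/-- The sum of a two-sided series. -/
def regSumInt (f : ℤ → ℂ) : ℂ :=
  regSum (fun i : ℕ => f i) + regSum (fun i : ℕ => f (-(i : ℤ) - 1))

/-- Infinite matrices, with rows and columns indexed by `ℤ`. -/
abbrev InfMat : Type := ℤ → ℤ → ℂ

/-- The product of infinite matrices. -/
def InfMat.mul (A B : InfMat) : InfMat := fun a b => regSumInt fun c => A a c * B c b

/-- The trace of an infinite matrix. -/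
def InfMat.tr (A : InfMat) : ℂ := regSumInt fun a => A a a

/-- The unit matrix. -/
def InfMat.one : InfMat := fun a b => if a = b then 1 else 0

/-- Powers of an infinite matrix. -/
def InfMat.pow (A : InfMat) : ℕ → InfMat
  | 0 => InfMat.one
  | i + 1 => InfMat.mul (InfMat.pow A i) A

/-- The product `M 0 * M 1 * ⋯ * M i`. -/
def InfMat.prod : (i : ℕ) → (Fin (i + 1) → InfMat) → InfMat
  | 0, M => M 0
  | i + 1, M => InfMat.mul (InfMat.prod i fun t => M t.castSucc) (M (Fin.last (i + 1)))

/-- The matrix `Λ`. -/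
def Lam : InfMat := fun a b => if a + 1 = b then 1 else 0

/-- The matrix `ᵗΛ`, which is also the inverse of `Λ`. -/
def tLam : InfMat := fun a b => if a = b + 1 then 1 else 0

/-- The matrix `O`. -/
def matO : InfMat := fun a b => if a = 0 ∧ 0 = b then 1 else 0

/-- The matrix `Ω = ∑ ᵗΛ ^ i * O * Λ ^ (-i - 1)`, where `Λ⁻¹ = ᵗΛ`. -/
def matOmega : InfMat := fun a b =>
  regSum fun i => InfMat.mul (InfMat.mul (InfMat.pow tLam i) matO) (InfMat.pow tLam (i + 1)) a b

/-- The vector `c(k)` (as a column) and `ᵗc(k)` (as a row). -/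
def vecC (k : ℂ) : ℤ → ℂ := fun a => k ^ a

/-! ### The tau function -/

/-- The data of the tau function. The measure on the contour `Γ j` is `dλ_j = w_j dμ_j`, with a
positive measure `μ j` and a complex density `w j`. Only the indices `j ∈ J` matter. -/
structure Data where
  /-- the period -/
  N : ℕ
  /-- the first level -/
  α : ℕ
  /-- the second level -/
  β : ℕ
  /-- the first lattice parameter -/
  p₁ : ℂ
  /-- the second lattice parameter -/
  p₂ : ℂ
  /-- the contours -/
  Γ : ℕ → Set ℂ
  /-- the positive measures -/
  μ : ℕ → Measure ℂ
  /-- the densities -/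
  w : ℕ → ℂ → ℂ

/-- The integers `0 < j < N` coprime to `N`. -/
def J (N : ℕ) : Finset ℕ := (Finset.range N).filter fun j => 0 < j ∧ j.Coprime N

/-- The root of unity `ω`. -/
def omega (N : ℕ) : ℂ := Complex.exp (2 * Real.pi * Complex.I / N)

namespace Data

variable (D : Data)

/-- The plane wave factor `ρ`. -/
def rho (n m r : ℤ) (k : ℂ) : ℂ :=
  (k ^ D.α * (D.p₁ + k)) ^ n * (k ^ D.β * (D.p₂ + k)) ^ m * k ^ r

/-- The plane wave factor `σ`. -/
def sigma (n m r : ℤ) (k' : ℂ) : ℂ :=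
  (k' ^ D.α * (D.p₁ + k')) ^ (-n) * (k' ^ D.β * (D.p₂ + k')) ^ (-m) * k' ^ (-r)

/-- The infinite matrix `ρ(k) c(k) ᵗc(ω^j k) σ(ω^j k)`, whose integral with respect to `dλ_j(k)`,
summed over `j ∈ J`, is the matrix `C`. -/
def densC (n m r : ℤ) (j : ℕ) (k : ℂ) : InfMat := fun a b =>
  D.rho n m r k * vecC k a * vecC (omega D.N ^ j * k) b * D.sigma n m r (omega D.N ^ j * k)

/-- The integrand of `tr (Ω C) ^ (i + 1)`, where each of the `i + 1` factors `C` is an integral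
with its own variable `k t`. -/
def traceIntegrand (n m r : ℤ) (i : ℕ) (j : Fin (i + 1) → J D.N) (k : Fin (i + 1) → ℂ) : ℂ :=
  (∏ t, D.w (j t) (k t)) *
    InfMat.tr (InfMat.prod i fun t => InfMat.mul matOmega (D.densC n m r (j t) (k t)))

/-- The product of the positive measures on the contours. -/
def prodMeasure (i : ℕ) (j : Fin (i + 1) → J D.N) : Measure (Fin (i + 1) → ℂ) :=
  Measure.pi fun t => (D.μ (j t)).restrict (D.Γ (j t))

/-- `tr (Ω C) ^ (i + 1)`, with the summations done under the integral signs. -/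
def trPow (n m r : ℤ) (i : ℕ) : ℂ :=
  ∑ j : Fin (i + 1) → J D.N, ∫ k, D.traceIntegrand n m r i j k ∂(D.prodMeasure i j)

/-- The `i`-th term of the series `tr log (1 + Ω C)`. -/
def logTerm (n m r : ℤ) (i : ℕ) : ℂ := (-1) ^ i / ((i : ℂ) + 1) * D.trPow n m r i

/-- The series `tr log (1 + ε Ω C)` as a formal power series in `ε`. -/
def logSeries (n m r : ℤ) : ℂ⟦X⟧ :=
  PowerSeries.mk fun s => if s = 0 then 0 else D.logTerm n m r (s - 1)

/-- The tau function `exp (tr log (1 + ε Ω C))` as a formal power series in `ε`, that is with all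
measures `dλ_j` multiplied by `ε`. The `i'`-th power of `logSeries` starts in degree `i'`, so that
the terms with `i' > s` do not contribute to the coefficient of `ε ^ s`. -/
def tauSeries (n m r : ℤ) : ℂ⟦X⟧ :=
  PowerSeries.mk fun s => ∑ i' ∈ Finset.range (s + 1),
    1 / (i'.factorial : ℂ) * PowerSeries.coeff s (D.logSeries n m r ^ i')

/-- The series `tr log (1 + Ω C)` converges to `L`. -/
def LogHasSum (n m r : ℤ) (L : ℂ) : Prop :=
  Tendsto (fun K : ℕ => ∑ i ∈ Finset.range K, D.logTerm n m r i) atTop (𝓝 L)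

/-- The series `tr log (1 + Ω C)` converges. -/
def LogConverges (n m r : ℤ) : Prop := ∃ L, D.LogHasSum n m r L

/-- The tau function as a number, meaningful where `LogConverges` holds. -/
def tau (n m r : ℤ) : ℂ :=
  ∑' i' : ℕ, 1 / (i'.factorial : ℂ) *
    (limUnder atTop fun K : ℕ => ∑ i ∈ Finset.range K, D.logTerm n m r i) ^ i'

/-- The standing assumptions: contours and measures are measurable objects, the plane wave factors
and the Cauchy kernels `1 / (l - ω^j k)` are regular on the contours, and all integrals that
occur in the traces converge absolutely. -/
structure Admissible : Prop where
  two_le : 2 ≤ D.N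
  α_lt : D.α < D.N
  β_lt : D.β < D.N
  measurableSet : ∀ j ∈ J D.N, MeasurableSet (D.Γ j)
  sigmaFinite : ∀ j ∈ J D.N, SigmaFinite (D.μ j)
  measurable : ∀ j ∈ J D.N, Measurable (D.w j)
  regular : ∀ j ∈ J D.N, ∀ k ∈ D.Γ j, k ≠ 0 ∧ D.p₁ + k ≠ 0 ∧ D.p₂ + k ≠ 0 ∧
    D.p₁ + omega D.N ^ j * k ≠ 0 ∧ D.p₂ + omega D.N ^ j * k ≠ 0
  kernel : ∀ j ∈ J D.N, ∀ k ∈ D.Γ j, ∀ j' ∈ J D.N, ∀ l ∈ D.Γ j', l ≠ omega D.N ^ j * k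
  integrable : ∀ (n m r : ℤ) (i : ℕ) (j : Fin (i + 1) → J D.N),
    Integrable (D.traceIntegrand n m r i j) (D.prodMeasure i j)

end Data

end FX

end

/-! Part 1 integrates compatible first order difference equations on the lattice
(`exists_lattice_recursion`). A periodic v with product 1 over each period determines τ at each (n,
m) up to a factor t(n, m). By (V), the ratio of the two sides of (B), written as in
`bilinearAt_iff`, does not depend on r; this ratio is absorbed by choosing t with the right discrete
mixed derivative (`exists_mixed_ratio`). For u, write the first two left sides of (T) as p₁ a and p₂
b. Then (U) is the compatibility condition for v_{n+1,m}^{(r)} = a v_{n,m}^{(r+α)}, v_{n,m+1}^{(r)}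
= b v_{n,m}^{(r+β)}, and because p₁ a - p₂ b is built from differences of u, this v solves (V),
which reduces to the previous case. Conversely, (B) at r and at r + 1 gives the compatibility
condition of the first two equations of (T) as equations for u, and the third one is their
difference (`bilinearAt_iff_uRelation`, `uRelation_of_bilinearAt`).

Part 2 identifies τ with a Fredholm determinant. The integrand of C has rank one, and its geometric
series sum to Cauchy kernels, so tr (ΩC)^{i+1} is the integral of the cyclic products of one scalar
kernel K(x, y) = w ρ σ / (y - ω^j x) on the disjoint union of the contours (`traceIntegrand_eq`,
`trPow_eq`). Newton's recursion between traces and integrated minors (`fredholmCoeff_succ`) shows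
that the coefficient of ε^s in τ is 1/s! times the integral of the s × s determinants of K
(`coeff_tauSeries_eq`). In a product of two such series the coefficient becomes the integral of a
sum over subsets S of a minor on S times a minor on the complement. Hence (B) follows from an
identity that holds pointwise on the contours: the Hirota–Miwa equation for Cauchy-type matrices
with the three parameters p₁, p₂, 0, in its multilinear part (`sum_minors_hirota_miwa`). It holds
because a shift perturbs the matrix by rank one and a double shift by rank two, up to diagonal
conjugation, which leaves a three-term Plücker relation of 2 × 2 determinants. For the numerical
statement, convergence of the logarithm at ε = 1 gives holomorphy for |ε| < 1. There the formal
identity is an identity of functions, and Abel's limit theorem carries it to ε = 1. -/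

noncomputable section

namespace FX

/-! ### Integration of difference equations on lattices -/

/-- A first order recursion by bijections has a two-sided solution. -/
theorem exists_int_recursion {S : Type*} (E : ℤ → S ≃ S) (s : S) :
    ∃ f : ℤ → S, f 0 = s ∧ ∀ n, f (n + 1) = E n (f n) := by
  let g : ℕ → S := fun k => Nat.rec s (fun k x => E k x) k
  let h : ℕ → S := fun k => Nat.rec s (fun k x => (E (-(k : ℤ) - 1)).symm x) k
  refine ⟨fun n => if 0 ≤ n then g n.toNat else h (-n).toNat, by simp [g], fun n => ?_⟩
  rcases le_or_gt 0 n with hn | hn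
  · lift n to ℕ using hn
    have h1 : (0 : ℤ) ≤ (n : ℤ) + 1 := by positivity
    have h2 : ((n : ℤ) + 1).toNat = n + 1 := by omega
    simp [h1, h2, g]
  · obtain ⟨k, rfl⟩ : ∃ k : ℕ, n = -(k : ℤ) - 1 := ⟨(-n - 1).toNat, by omega⟩
    have h2 : (-(-(k : ℤ) - 1)).toNat = k + 1 := by omega
    have h3 : ¬ (0 : ℤ) ≤ -(k : ℤ) - 1 := by omega
    have h4 : -(k : ℤ) - 1 + 1 = -k := by ring
    simp only [h2, h3, h4, if_false]
    rcases Nat.eq_zero_or_pos k with rfl | hk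
    · simp [g, h]
    · have h5 : ¬ (0 : ℤ) ≤ -(k : ℤ) := by omega
      simp [h, hk.ne']

/-- Two commuting families of bijections on the lattice `ℤ × ℤ` have a common solution. -/
theorem exists_lattice_recursion {S : Type*} (E F : ℤ → ℤ → S ≃ S)
    (hEF : ∀ n m x, F (n + 1) m (E n m x) = E n (m + 1) (F n m x)) (s : S) :
    ∃ f : ℤ → ℤ → S, f 0 0 = s ∧ (∀ n m, f (n + 1) m = E n m (f n m)) ∧
      ∀ n m, f n (m + 1) = F n m (f n m) := by
  obtain ⟨f₀, h0, hf₀⟩ := exists_int_recursion (fun n => E n 0) s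
  choose f hf0 hf using fun n => exists_int_recursion (F n) (f₀ n)
  refine ⟨f, by rw [hf0, h0], fun n m => ?_, hf⟩
  -- Injectivity of `F` makes the equation at m equivalent to the one at m + 1, so a single
  -- induction from m = 0 runs in both directions.
  have step : ∀ m, f (n + 1) m = E n m (f n m) ↔ f (n + 1) (m + 1) = E n (m + 1) (f n (m + 1)) := by
    intro m
    rw [hf, hf, ← hEF, (F (n + 1) m).apply_eq_iff_eq]
  induction m using Int.induction_on with
  | zero => rw [hf0, hf0, hf₀]
  | succ i ih => exact (step i).1 ih
  | pred i ih =>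
    rw [step]
    simpa using ih

theorem int_eq_of_step {S : Type*} {f : ℤ → S} (h : ∀ s, f (s + 1) = f s) (s : ℤ) : f s = f 0 := by
  induction s using Int.induction_on with
  | zero => rfl
  | succ i ih => rw [h, ih]
  | pred i ih => rw [← ih, ← h (-(i : ℤ) - 1)]; simp

/-- The product over a period does not depend on the starting point. -/
theorem prod_period_shift {N : ℕ} {g : ℤ → ℂ} (hg : ∀ r, g (r + N) = g r) (h0 : ∀ r, g r ≠ 0)
    (s : ℤ) : ∏ k ∈ Finset.range N, g (k + s) = ∏ k ∈ Finset.range N, g k := by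
  have := int_eq_of_step (f := fun s => ∏ k ∈ Finset.range N, g (k + s)) (fun s => ?_) s
  · simpa using this
  have h1 := Finset.prod_range_succ (fun k : ℕ => g (k + s)) N
  rw [Finset.prod_range_succ', add_comm (N : ℤ) s, hg] at h1
  rw [Nat.cast_zero, zero_add] at h1
  rw [← mul_right_cancel₀ (h0 s) h1]
  refine Finset.prod_congr rfl fun k _ => ?_
  congr 1
  push_cast
  ring

/-- A function with product `1` over each period is the ratio of a periodic function and its
shift. -/
theorem exists_periodic_ratio {N : ℕ} {v : ℤ → ℂ} (hv : ∀ r, v (r + N) = v r)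
    (h0 : ∀ r, v r ≠ 0) (h1 : ∏ k ∈ Finset.range N, v k = 1) :
    ∃ θ : ℤ → ℂ, (∀ r, θ r ≠ 0) ∧ (∀ r, θ (r + N) = θ r) ∧ ∀ r, θ (r + 1) = v r * θ r := by
  -- Recursion in the group of units makes the solution nonvanishing automatically.
  obtain ⟨f, -, hf⟩ := exists_int_recursion (fun r => Equiv.mulLeft (Units.mk0 (v r) (h0 r))) 1
  have hf' : ∀ r, (f (r + 1) : ℂ) = v r * f r := fun r => by rw [hf]; simp
  refine ⟨fun r => f r, fun r => (f r).ne_zero, fun r => ?_, hf'⟩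
  have key : ∀ j : ℕ, (f (r + j) : ℂ) = (∏ k ∈ Finset.range j, v (k + r)) * f r := by
    intro j
    induction j with
    | zero => simp
    | succ j ih =>
      rw [Finset.prod_range_succ, Nat.cast_succ, ← add_assoc, hf', ih, add_comm (j : ℤ)]
      ring
  simp only [key, prod_period_shift hv h0, h1, one_mul]

/-- Every nowhere vanishing function on `ℤ × ℤ` is a discrete mixed derivative. -/
theorem exists_mixed_ratio (R : ℤ → ℤ → ℂ) (hR : ∀ n m, R n m ≠ 0) :
    ∃ t : ℤ → ℤ → ℂ, (∀ n m, t n m ≠ 0) ∧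
      ∀ n m, t (n + 1) (m + 1) * t n m = R n m * (t (n + 1) m * t n (m + 1)) := by
  -- Two successive summations in multiplicative form: g integrates R in the direction of m, and t
  -- integrates g in the direction of n.
  choose g hg0 hg using fun n =>
    exists_int_recursion (fun m => Equiv.mulLeft (Units.mk0 (R n m) (hR n m))) 1
  choose t ht0 ht using fun m => exists_int_recursion (fun n => Equiv.mulLeft (g n m)) 1
  refine ⟨fun n m => t m n, fun n m => (t m n).ne_zero, fun n m => ?_⟩
  simp only [ht, hg, Equiv.coe_mulLeft, Units.val_mul, Units.val_mk0]
  ring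

/-! ### The quotient potential -/

theorem bilinearAt_iff {α β : ℕ} {p₁ p₂ : ℂ} {τ : ℤ → ℤ → ℤ → ℂ} {n m r : ℤ} :
    BilinearAt α β p₁ p₂ τ n m r ↔
      (p₁ - p₂) * (τ n m (r + 1 + α + β) * τ (n + 1) (m + 1) r) =
        p₁ * (τ n (m + 1) (r + α) * τ (n + 1) m (r + 1 + β)) -
        p₂ * (τ (n + 1) m (r + β) * τ n (m + 1) (r + 1 + α)) := by
  rw [BilinearAt, smul_eq_mul, smul_eq_mul]
  constructor <;> intro h <;> linear_combination h

/-- After clearing denominators, each side of (V) is a product of two values of τ times the right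
side of `bilinearAt_iff`, at r on one side and at r + 1 on the other. By (B) both equal p₁ - p₂
times the same product of four values of τ. -/
theorem vSystem_of_bilinear {N α β : ℕ} {p₁ p₂ : ℂ} {τ v : ℤ → ℤ → ℤ → ℂ}
    (h0 : ∀ n m r, τ n m r ≠ 0) (hτ : BilinearSystem N α β p₁ p₂ τ) (hv : VTransform v τ) :
    VSystem N α β p₁ p₂ v := by
  refine ⟨fun n m r => ?_, fun n m r => ?_, fun n m r => ?_⟩
  · rw [hv, hv, hτ.1, show r + N + 1 = r + 1 + N by ring, hτ.1]
  · rw [hv]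
    exact div_ne_zero (h0 _ _ _) (h0 _ _ _)
  · have b0 := bilinearAt_iff.1 (hτ.2 n m r)
    have b1 := bilinearAt_iff.1 (hτ.2 n m (r + 1))
    rw [hv, hv, hv, hv, hv, hv]
    rw [show r + 1 + 1 + (α : ℤ) + β = r + 1 + α + β + 1 by ring,
      show r + 1 + 1 + (β : ℤ) = r + 1 + β + 1 by ring,
      show r + 1 + 1 + (α : ℤ) = r + 1 + α + 1 by ring] at b1
    rw [show r + (α : ℤ) + 1 = r + 1 + α by ring, show r + (β : ℤ) + 1 = r + 1 + β by ring]
    have hA := h0 n m (r + 1 + α + β)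
    have hA1 := h0 n m (r + 1 + α + β + 1)
    have hB := h0 (n + 1) (m + 1) r
    have hC := h0 n (m + 1) (r + 1 + α)
    have hD := h0 (n + 1) m (r + 1 + β)
    have hC' := h0 n (m + 1) (r + α)
    have hD' := h0 (n + 1) m (r + β)
    generalize τ n m (r + 1 + α + β) = A at *
    generalize τ n m (r + 1 + α + β + 1) = A1 at *
    generalize τ (n + 1) (m + 1) r = B at *
    generalize τ (n + 1) (m + 1) (r + 1) = B1 at *
    generalize τ n (m + 1) (r + 1 + α) = C at *
    generalize τ n (m + 1) (r + 1 + α + 1) = C1 at *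
    generalize τ (n + 1) m (r + 1 + β) = D at *
    generalize τ (n + 1) m (r + 1 + β + 1) = D1 at *
    generalize τ n (m + 1) (r + α) = C' at *
    generalize τ (n + 1) m (r + β) = D' at *
    field_simp
    linear_combination (-B1 * A1) * b0 + B * A * b1

/-- The local solutions θ(n, m, ·) of θ^{(r+1)} = v θ^{(r)} are unrelated at different (n, m). The
ratio R of the two sides of (B) for θ is independent of r by (V), and nonzero by the genericity
assumption. Passing to t θ multiplies the two sides by t_{n,m} t_{n+1,m+1} and t_{n+1,m} t_{n,m+1},
so (B) holds once t has mixed ratio R. -/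
theorem exists_tau_of_vSystem {N α β : ℕ} {p₁ p₂ : ℂ} (hp : p₁ ≠ p₂) {v : ℤ → ℤ → ℤ → ℂ}
    (hv : VSystem N α β p₁ p₂ v) (h1 : ∀ n m : ℤ, ∏ r ∈ Finset.range N, v n m r = 1)
    (hgen : ∀ n m r : ℤ, p₁ * v (n + 1) m (r + β) ≠ p₂ * v n (m + 1) (r + α)) :
    ∃ τ : ℤ → ℤ → ℤ → ℂ, (∀ n m r, τ n m r ≠ 0) ∧
      BilinearSystem N α β p₁ p₂ τ ∧ VTransform v τ := by
  obtain ⟨hper, h0, heq⟩ := hv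
  choose θ hθ0 hθN hθ using fun n m => exists_periodic_ratio (hper n m) (h0 n m) (h1 n m)
  have hp' := sub_ne_zero.2 hp
  let R : ℤ → ℤ → ℤ → ℂ := fun n m r =>
    (p₁ * (θ n (m + 1) (r + α) * θ (n + 1) m (r + 1 + β)) -
        p₂ * (θ (n + 1) m (r + β) * θ n (m + 1) (r + 1 + α))) /
      ((p₁ - p₂) * (θ n m (r + 1 + α + β) * θ (n + 1) (m + 1) r))
  have hR : ∀ n m r, R n m r = θ n (m + 1) (r + α) * θ (n + 1) m (r + β) *
      (p₁ * v (n + 1) m (r + β) - p₂ * v n (m + 1) (r + α)) /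
      ((p₁ - p₂) * (θ n m (r + 1 + α + β) * θ (n + 1) (m + 1) r)) := by
    intro n m r
    simp only [R]
    rw [show r + 1 + (β : ℤ) = r + β + 1 by ring, hθ (n + 1) m, 
      show r + 1 + (α : ℤ) = r + α + 1 by ring, hθ n (m + 1)]
    congr 1
    ring
  have hstep : ∀ n m r, R n m (r + 1) = R n m r := by
    intro n m r
    rw [hR, hR, div_eq_div_iff (mul_ne_zero hp' (mul_ne_zero (hθ0 _ _ _) (hθ0 _ _ _)))
      (mul_ne_zero hp' (mul_ne_zero (hθ0 _ _ _) (hθ0 _ _ _))),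
      show r + 1 + 1 + (α : ℤ) + β = r + 1 + α + β + 1 by ring, hθ n m, hθ (n + 1) (m + 1)]
    have e := heq n m r
    have hA := h0 n m (r + 1 + α + β)
    have hC := h0 n (m + 1) (r + α)
    have hD := h0 (n + 1) m (r + β)
    have e1 : θ n (m + 1) (r + 1 + α) = v n (m + 1) (r + α) * θ n (m + 1) (r + α) := by
      rw [show r + 1 + (α : ℤ) = r + α + 1 by ring, hθ]
    have e2 : θ (n + 1) m (r + 1 + β) = v (n + 1) m (r + β) * θ (n + 1) m (r + β) := by
      rw [show r + 1 + (β : ℤ) = r + β + 1 by ring, hθ]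
    rw [e1, e2]
    generalize v n m (r + 1 + α + β) = A at *
    generalize v n (m + 1) (r + α) = C at *
    generalize v (n + 1) m (r + β) = D at *
    field_simp at e
    linear_combination (θ n (m + 1) (r + α) * θ (n + 1) m (r + β) * (p₁ - p₂) *
      θ n m (r + 1 + α + β) * θ (n + 1) (m + 1) r) * (-e)
  have hconst : ∀ n m r, R n m r = R n m 0 := fun n m => int_eq_of_step (hstep n m)
  obtain ⟨t, ht0, ht⟩ := exists_mixed_ratio (fun n m => R n m 0) fun n m => by
    rw [hR]
    exact div_ne_zero (mul_ne_zero (mul_ne_zero (hθ0 _ _ _) (hθ0 _ _ _))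
      (sub_ne_zero.2 (hgen _ _ _))) (mul_ne_zero hp' (mul_ne_zero (hθ0 _ _ _) (hθ0 _ _ _)))
  refine ⟨fun n m r => t n m * θ n m r, fun n m r => mul_ne_zero (ht0 _ _) (hθ0 _ _ _),
    ⟨fun n m r => ?_, fun n m r => ?_⟩, fun n m r => ?_⟩
  · simp only [hθN]
  · rw [bilinearAt_iff]
    have e := ht n m
    simp only [← hconst n m r, R] at e
    rw [div_mul_eq_mul_div, eq_div_iff
      (mul_ne_zero hp' (mul_ne_zero (hθ0 _ _ _) (hθ0 _ _ _)))] at e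
    linear_combination e
  · simp only [hθ]
    rw [mul_left_comm, mul_div_assoc, div_self (mul_ne_zero (ht0 _ _) (hθ0 _ _ _)), mul_one]

theorem vHasBilinearForm (N α β : ℕ) (p₁ p₂ : ℂ) : VHasBilinearForm N α β p₁ p₂ :=
  ⟨fun _ _ h0 hτ hv => vSystem_of_bilinear h0 hτ hv,
    fun hp _ hv h1 hgen => exists_tau_of_vSystem hp hv h1 hgen⟩

/-! ### The additive potential -/

/-- The right-hand sides of the transformation between `u` and `τ` satisfy the same linear relation
as the left-hand sides if and only if `τ` solves the bilinear equation. -/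
theorem bilinearAt_iff_uRelation {α β : ℕ} {p₁ p₂ : ℂ} {τ : ℤ → ℤ → ℤ → ℂ}
    (h0 : ∀ n m r, τ n m r ≠ 0) {n m r : ℤ} :
    BilinearAt α β p₁ p₂ τ n m r ↔
      p₁ * (τ n m (r + β + α) * τ (n + 1) m (r + β + 1) /
        (τ n m (r + β + 1 + α) * τ (n + 1) m (r + β))) -
      p₂ * (τ n m (r + α + β) * τ n (m + 1) (r + α + 1) /
        (τ n m (r + α + 1 + β) * τ n (m + 1) (r + α))) =
      (p₁ - p₂) * (τ n m (r + α + β) * τ (n + 1) (m + 1) r /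
        (τ n (m + 1) (r + α) * τ (n + 1) m (r + β))) := by
  rw [bilinearAt_iff, show r + (β : ℤ) + α = r + α + β by ring,
    show r + (β : ℤ) + 1 + α = r + 1 + α + β by ring,
    show r + (α : ℤ) + 1 + β = r + 1 + α + β by ring, 
    show r + (α : ℤ) + 1 = r + 1 + α by ring, show r + (β : ℤ) + 1 = r + 1 + β by ring]
  have hA := h0 n m (r + 1 + α + β)
  have hX := h0 n m (r + α + β)
  have hC := h0 n (m + 1) (r + α)
  have hD := h0 (n + 1) m (r + β)
  generalize τ n m (r + 1 + α + β) = A at *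
  generalize τ n m (r + α + β) = X at *
  generalize τ n (m + 1) (r + α) = C at *
  generalize τ (n + 1) m (r + β) = D at *
  generalize τ n (m + 1) (r + 1 + α) = C1 at *
  generalize τ (n + 1) m (r + 1 + β) = D1 at *
  field_simp
  constructor <;> intro h <;> linear_combination -h

/-- A second consequence of the bilinear equation for the same quotients. -/
theorem uRelation_of_bilinearAt {α β : ℕ} {p₁ p₂ : ℂ} {τ : ℤ → ℤ → ℤ → ℂ}
    (h0 : ∀ n m r, τ n m r ≠ 0) {n m r : ℤ} (h : BilinearAt α β p₁ p₂ τ n m r) :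
    p₁ * (τ n (m + 1) (r + α) * τ (n + 1) (m + 1) (r + 1) /
        (τ n (m + 1) (r + 1 + α) * τ (n + 1) (m + 1) r)) -
      p₂ * (τ (n + 1) m (r + β) * τ (n + 1) (m + 1) (r + 1) /
        (τ (n + 1) m (r + 1 + β) * τ (n + 1) (m + 1) r)) =
      (p₁ - p₂) * (τ n m (r + 1 + α + β) * τ (n + 1) (m + 1) (r + 1) /
        (τ n (m + 1) (r + 1 + α) * τ (n + 1) m (r + 1 + β))) := by
  rw [bilinearAt_iff] at h
  have hC := h0 n (m + 1) (r + 1 + α)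
  have hD := h0 (n + 1) m (r + 1 + β)
  have hB := h0 (n + 1) (m + 1) r
  generalize τ n (m + 1) (r + 1 + α) = C at *
  generalize τ (n + 1) m (r + 1 + β) = D at *
  generalize τ (n + 1) (m + 1) r = B at *
  field_simp
  linear_combination (-τ (n + 1) (m + 1) (r + 1)) * h

/-- The third left side of (T) is the first at r + β minus the second at r + α; the same relation
between the right sides is (B). -/
theorem bilinear_of_uTransform {α β : ℕ} {p₁ p₂ : ℂ} {u τ : ℤ → ℤ → ℤ → ℂ}
    (h0 : ∀ n m r, τ n m r ≠ 0) (hu : UTransform α β p₁ p₂ u τ) (n m r : ℤ) :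
    BilinearAt α β p₁ p₂ τ n m r := by
  rw [bilinearAt_iff_uRelation h0, ← (hu n m (r + β)).1, ← (hu n m (r + α)).2.1,
    ← (hu n m r).2.2, show r + (β : ℤ) + 1 + α = r + α + 1 + β by ring]
  ring

/-- Periodic solutions of two linear first order equations under the compatibility condition. -/
theorem exists_additive_potential {N α β : ℕ} {X Y : ℤ → ℤ → ℤ → ℂ} (hX : IsPeriodic N X)
    (hY : IsPeriodic N Y) (hXY : ∀ n m r, X n m (r + 1 + β) + Y (n + 1) m r =
      X n (m + 1) r + Y n m (r + 1 + α)) :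
    ∃ u, IsPeriodic N u ∧ (∀ n m r, u n m (r + 1 + α) - u (n + 1) m r = X n m r) ∧
      ∀ n m r, u n m (r + 1 + β) - u n (m + 1) r = Y n m r := by
  -- The state at (n, m) is the whole periodic sequence in r. A lattice step is then a shift
  -- followed by a translation, hence a bijection of S, and the compatibility condition says that
  -- the two steps commute.
  let S := {g : ℤ → ℂ // ∀ r, g (r + N) = g r}
  let E : ℕ → {X : ℤ → ℂ // ∀ r, X (r + N) = X r} → S ≃ S := fun a X =>
    { toFun := fun g => ⟨fun r => g.1 (r + 1 + a) - X.1 r, fun r => by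
        beta_reduce
        rw [X.2, show r + N + 1 + (a : ℤ) = r + 1 + a + N by ring, g.2]⟩
      invFun := fun g => ⟨fun r => g.1 (r - 1 - a) + X.1 (r - 1 - a), fun r => by
        beta_reduce
        rw [show r + N - 1 - (a : ℤ) = r - 1 - a + N by ring, g.2, X.2]⟩
      left_inv := fun g => by
        ext r
        change g.1 (r - 1 - a + 1 + a) - X.1 (r - 1 - a) + X.1 (r - 1 - a) = g.1 r
        rw [sub_add_cancel, show r - 1 - (a : ℤ) + 1 + a = r by ring]
      right_inv := fun g => by
        ext r
        change g.1 (r + 1 + a - 1 - a) + X.1 (r + 1 + a - 1 - a) - X.1 r = g.1 r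
        rw [show r + 1 + (a : ℤ) - 1 - a = r by ring, add_sub_cancel_right] }
  obtain ⟨f, -, hf1, hf2⟩ := exists_lattice_recursion (S := S)
    (fun n m => E α ⟨X n m, hX n m⟩) (fun n m => E β ⟨Y n m, hY n m⟩) (fun n m g => by
      ext r
      change g.1 (r + 1 + β + 1 + α) - X n m (r + 1 + β) - Y (n + 1) m r =
        g.1 (r + 1 + α + 1 + β) - Y n m (r + 1 + α) - X n (m + 1) r
      rw [show r + 1 + (β : ℤ) + 1 + α = r + 1 + α + 1 + β by ring]
      linear_combination -hXY n m r) ⟨fun _ => 0, fun _ => rfl⟩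
  refine ⟨fun n m => (f n m).1, fun n m => (f n m).2, fun n m r => ?_, fun n m r => ?_⟩
  · beta_reduce
    rw [hf1]
    exact sub_sub_cancel _ _
  · beta_reduce
    rw [hf2]
    exact sub_sub_cancel _ _

/-- Compatibility of the first two equations of (T) holds because both sides reduce to the same
quotient of values of τ: one by (B) at r + 1, the other by the second consequence of (B) at r. -/
theorem exists_uTransform_of_bilinear {N α β : ℕ} {p₁ p₂ : ℂ} {τ : ℤ → ℤ → ℤ → ℂ}
    (h0 : ∀ n m r, τ n m r ≠ 0) (hτ : BilinearSystem N α β p₁ p₂ τ) :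
    ∃ u, IsPeriodic N u ∧ UTransform α β p₁ p₂ u τ := by
  have hN : ∀ (n m r s : ℤ), τ n m (r + N + s) = τ n m (r + s) := fun n m r s => by
    rw [show r + N + s = r + s + N by ring, hτ.1]
  obtain ⟨u, hu, hu1, hu2⟩ := exists_additive_potential (N := N) (α := α) (β := β)
    (X := fun n m r => p₁ * (τ n m (r + α) * τ (n + 1) m (r + 1) /
      (τ n m (r + 1 + α) * τ (n + 1) m r)) - p₁)
    (Y := fun n m r => p₂ * (τ n m (r + β) * τ n (m + 1) (r + 1) /
      (τ n m (r + 1 + β) * τ n (m + 1) r)) - p₂)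
    (fun n m r => by simp only [hτ.1 _ _ r, add_assoc (r + (N : ℤ)), hN, add_assoc r 1])
    (fun n m r => by simp only [hτ.1 _ _ r, add_assoc (r + (N : ℤ)), hN, add_assoc r 1])
    (fun n m r => by
      have e1 := uRelation_of_bilinearAt h0 (hτ.2 n m r)
      have e2 := (bilinearAt_iff_uRelation h0).1 (hτ.2 n m (r + 1))
      rw [show r + 1 + (β : ℤ) + α = r + 1 + α + β by ring] at *
      linear_combination e2 - e1)
  refine ⟨u, hu, fun n m r => ⟨by linear_combination hu1 n m r, by linear_combination hu2 n m r, ?_⟩⟩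
  rw [← (bilinearAt_iff_uRelation h0).1 (hτ.2 n m r)]
  have e1 := hu1 n m (r + β)
  have e2 := hu2 n m (r + α)
  rw [show r + (α : ℤ) + 1 + β = r + β + 1 + α by ring] at *
  linear_combination e1 - e2

/-- After substitution of the first two equations of (T), (U) becomes an identity of monomials in τ,
in which p₁ and p₂ cancel. -/
theorem uSystem_of_uTransform {N α β : ℕ} {p₁ p₂ : ℂ} (hp₁ : p₁ ≠ 0) (hp₂ : p₂ ≠ 0)
    {u τ : ℤ → ℤ → ℤ → ℂ} (h0 : ∀ n m r, τ n m r ≠ 0) (hper : IsPeriodic N u)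
    (hu : UTransform α β p₁ p₂ u τ) : USystem N α β p₁ p₂ u := by
  refine ⟨hper, fun n m r => ?_⟩
  have e1 := (hu n m (r + β)).1
  have e2 := (hu n m (r + α)).2.1
  have e3 := (hu n (m + 1) r).1
  have e4 := (hu (n + 1) m r).2.1
  rw [show r + (β : ℤ) + 1 + α = r + 1 + α + β by ring,
    show r + (β : ℤ) + α = r + α + β by ring] at e1
  rw [show r + (α : ℤ) + 1 + β = r + 1 + α + β by ring] at e2
  rw [e1, e2, e3, e4, show r + (α : ℤ) + 1 = r + 1 + α by ring,
    show r + (β : ℤ) + 1 = r + 1 + β by ring]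
  have h1 := h0 n m (r + 1 + α + β)
  have h2 := h0 n m (r + α + β)
  have h3 := h0 n (m + 1) (r + α)
  have h4 := h0 (n + 1) m (r + β)
  have h5 := h0 n (m + 1) (r + 1 + α)
  have h6 := h0 (n + 1) m (r + 1 + β)
  have h7 := h0 (n + 1) (m + 1) r
  generalize τ n m (r + 1 + α + β) = t1 at *
  generalize τ n m (r + α + β) = t2 at *
  generalize τ n (m + 1) (r + α) = t3 at *
  generalize τ (n + 1) m (r + β) = t4 at *
  generalize τ n (m + 1) (r + 1 + α) = t5 at *
  generalize τ (n + 1) m (r + 1 + β) = t6 at *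
  generalize τ (n + 1) (m + 1) r = t7 at *
  exact ⟨by positivity, by positivity, by field_simp⟩

/-- Periodic nonvanishing solutions with product `1` over a period of two multiplicative first
order equations under the compatibility condition. -/
theorem exists_quotient_potential {N α β : ℕ} {a b : ℤ → ℤ → ℤ → ℂ} (ha : IsPeriodic N a)
    (hb : IsPeriodic N b) (ha0 : ∀ n m r, a n m r ≠ 0) (hb0 : ∀ n m r, b n m r ≠ 0)
    (ha1 : ∀ n m, ∏ k ∈ Finset.range N, a n m k = 1)
    (hb1 : ∀ n m, ∏ k ∈ Finset.range N, b n m k = 1)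
    (hab : ∀ n m r, a n m (r + β) * b (n + 1) m r = a n (m + 1) r * b n m (r + α)) :
    ∃ v, IsPeriodic N v ∧ (∀ n m r, v n m r ≠ 0) ∧
      (∀ n m, ∏ k ∈ Finset.range N, v n m k = 1) ∧
      (∀ n m r, v (n + 1) m r = a n m r * v n m (r + α)) ∧
      ∀ n m r, v n (m + 1) r = b n m r * v n m (r + β) := by
  -- Nonvanishing and product 1 are built into the state space: they survive a shift by periodicity,
  -- and multiplication by a or b, which have these properties too.
  let S := {g : ℤ → ℂ // (∀ r, g (r + N) = g r) ∧ (∀ r, g r ≠ 0) ∧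
    ∏ k ∈ Finset.range N, g k = 1}
  let E : ℕ → S → S ≃ S := fun d c =>
    { toFun := fun g => ⟨fun r => c.1 r * g.1 (r + d), fun r => by
          beta_reduce
          rw [c.2.1, show r + N + (d : ℤ) = r + d + N by ring, g.2.1],
        fun r => mul_ne_zero (c.2.2.1 _) (g.2.2.1 _), by
          rw [Finset.prod_mul_distrib, c.2.2.2, prod_period_shift g.2.1 g.2.2.1, g.2.2.2,
            one_mul]⟩
      invFun := fun g => ⟨fun r => g.1 (r - d) / c.1 (r - d), fun r => by
          beta_reduce
          rw [show r + N - (d : ℤ) = r - d + N by ring, g.2.1, c.2.1],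
        fun r => div_ne_zero (g.2.2.1 _) (c.2.2.1 _), by
          simp only [sub_eq_add_neg]
          rw [Finset.prod_div_distrib, prod_period_shift g.2.1 g.2.2.1,
            prod_period_shift c.2.1 c.2.2.1, g.2.2.2, c.2.2.2, one_div_one]⟩
      left_inv := fun g => by
        ext r
        change c.1 (r - d) * g.1 (r - d + d) / c.1 (r - d) = g.1 r
        rw [mul_div_cancel_left₀ _ (c.2.2.1 _), sub_add_cancel]
      right_inv := fun g => by
        ext r
        change c.1 r * (g.1 (r + d - d) / c.1 (r + d - d)) = g.1 r
        rw [add_sub_cancel_right, mul_div_cancel₀ _ (c.2.2.1 _)] }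
  obtain ⟨f, -, hf1, hf2⟩ := exists_lattice_recursion (S := S)
    (fun n m => E α ⟨a n m, ha n m, ha0 n m, ha1 n m⟩)
    (fun n m => E β ⟨b n m, hb n m, hb0 n m, hb1 n m⟩) (fun n m g => by
      ext r
      change b (n + 1) m r * (a n m (r + β) * g.1 (r + β + α)) =
        a n (m + 1) r * (b n m (r + α) * g.1 (r + α + β))
      rw [add_right_comm r (β : ℤ)]
      linear_combination g.1 (r + α + β) * hab n m r)
    ⟨fun _ => 1, fun _ => rfl, fun _ => one_ne_zero, by simp⟩
  refine ⟨fun n m => (f n m).1, fun n m => (f n m).2.1, fun n m => (f n m).2.2.1,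
    fun n m => (f n m).2.2.2, fun n m r => ?_, fun n m r => ?_⟩
  · beta_reduce
    rw [hf1]
    rfl
  · beta_reduce
    rw [hf2]
    rfl

/-- With a and b the first two left sides of (T) divided by p₁ and p₂, (U) is the compatibility
condition for a v with v_{n+1,m}^{(r)} = a v_{n,m}^{(r+α)} and v_{n,m+1}^{(r)} = b v_{n,m}^{(r+β)}.
The first integrals give a and b product 1 over a period, and the last assumption becomes the
genericity of v, so τ comes from the quotient potential. -/
theorem exists_tau_of_uSystem {N α β : ℕ} {p₁ p₂ : ℂ} (hp₁ : p₁ ≠ 0) (hp₂ : p₂ ≠ 0)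
    (hp : p₁ ≠ p₂) {u : ℤ → ℤ → ℤ → ℂ} (hu : USystem N α β p₁ p₂ u)
    (hu1 : ∀ n m : ℤ, ∏ r ∈ Finset.range N, (p₁ + u n m (r + 1 + α) - u (n + 1) m r) = p₁ ^ N)
    (hu2 : ∀ n m : ℤ, ∏ r ∈ Finset.range N, (p₂ + u n m (r + 1 + β) - u n (m + 1) r) = p₂ ^ N)
    (hu3 : ∀ n m r : ℤ, p₁ - p₂ + u n (m + 1) (r + α) - u (n + 1) m (r + β) ≠ 0) :
    ∃ τ : ℤ → ℤ → ℤ → ℂ, (∀ n m r, τ n m r ≠ 0) ∧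
      BilinearSystem N α β p₁ p₂ τ ∧ UTransform α β p₁ p₂ u τ := by
  obtain ⟨hper, hsys⟩ := hu
  have hN : ∀ (n m r s : ℤ), u n m (r + N + s) = u n m (r + s) := fun n m r s => by
    rw [show r + N + s = r + s + N by ring, hper]
  obtain ⟨a, ha⟩ : ∃ a : ℤ → ℤ → ℤ → ℂ, ∀ n m r,
      p₁ + u n m (r + 1 + α) - u (n + 1) m r = p₁ * a n m r :=
    ⟨fun n m r => (p₁ + u n m (r + 1 + α) - u (n + 1) m r) / p₁, fun n m r => by field_simp⟩
  obtain ⟨b, hb⟩ : ∃ b : ℤ → ℤ → ℤ → ℂ, ∀ n m r,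
      p₂ + u n m (r + 1 + β) - u n (m + 1) r = p₂ * b n m r :=
    ⟨fun n m r => (p₂ + u n m (r + 1 + β) - u n (m + 1) r) / p₂, fun n m r => by field_simp⟩
  have ha' : ∀ n m r, p₁ + u n m (r + 1 + α + β) - u (n + 1) m (r + β) = p₁ * a n m (r + β) :=
    fun n m r => by rw [← ha, show r + (β : ℤ) + 1 + α = r + 1 + α + β by ring]
  have hb' : ∀ n m r, p₂ + u n m (r + 1 + α + β) - u n (m + 1) (r + α) = p₂ * b n m (r + α) :=
    fun n m r => by rw [← hb, show r + (α : ℤ) + 1 + β = r + 1 + α + β by ring]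
  have ha0 : ∀ n m r, a n m r ≠ 0 := fun n m r h => by
    have := (hsys n m (r - β)).1
    rw [ha', sub_add_cancel, h, mul_zero] at this
    exact this rfl
  have hb0 : ∀ n m r, b n m r ≠ 0 := fun n m r h => by
    have := (hsys n m (r - α)).2.1
    rw [hb', sub_add_cancel, h, mul_zero] at this
    exact this rfl
  obtain ⟨v, hv, hv0, hv1, hva, hvb⟩ := exists_quotient_potential (N := N) (α := α) (β := β)
    (a := a) (b := b)
    (fun n m r => mul_left_cancel₀ hp₁ (by rw [← ha, ← ha, add_assoc (r + N), hN, hper, add_assoc r]))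
    (fun n m r => mul_left_cancel₀ hp₂ (by rw [← hb, ← hb, add_assoc (r + N), hN, hper, add_assoc r]))
    ha0 hb0
    (fun n m => by
      have := hu1 n m
      simp only [ha, Finset.prod_mul_distrib, Finset.prod_const, Finset.card_range] at this
      exact mul_left_cancel₀ (pow_ne_zero N hp₁) (this.trans (mul_one _).symm))
    (fun n m => by
      have := hu2 n m
      simp only [hb, Finset.prod_mul_distrib, Finset.prod_const, Finset.card_range] at this
      exact mul_left_cancel₀ (pow_ne_zero N hp₂) (this.trans (mul_one _).symm))
    (fun n m r => by
      have e := (hsys n m r).2.2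
      rw [ha', hb', ha, hb, mul_div_mul_left _ _ hp₁, mul_div_mul_left _ _ hp₂,
        div_eq_div_iff (ha0 _ _ _) (hb0 _ _ _)] at e
      linear_combination -e)
  have hdiff : ∀ n m r, p₁ - p₂ + u n (m + 1) (r + α) - u (n + 1) m (r + β) =
      p₁ * a n m (r + β) - p₂ * b n m (r + α) := fun n m r => by
    rw [← ha', ← hb']
    ring
  obtain ⟨τ, hτ0, hτ, hvτ⟩ := exists_tau_of_vSystem (α := α) (β := β) hp (v := v) ⟨hv, hv0, fun n m r => by
      -- This is (V) in terms of a and b: on the left the value of u at (n + 1, m + 1) cancels, on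
      -- the right the value at (n, m), and the same difference of u remains.
      have e : p₁ * a n (m + 1) r - p₂ * b (n + 1) m r =
          p₁ * a n m (r + 1 + β) - p₂ * b n m (r + 1 + α) := by
        rw [← hdiff, ← ha, ← hb]
        ring
      have e1 : v (n + 1) (m + 1) r = a n (m + 1) r * v n (m + 1) (r + α) := hva _ _ _
      have e2 : v (n + 1) (m + 1) r = b (n + 1) m r * v (n + 1) m (r + β) := hvb _ _ _
      have e3 : v (n + 1) m (r + 1 + β) = a n m (r + 1 + β) * v n m (r + 1 + α + β) := by
        rw [hva, add_right_comm (r + 1)]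
      have e4 : v n (m + 1) (r + 1 + α) = b n m (r + 1 + α) * v n m (r + 1 + α + β) := hvb _ _ _
      rw [e3, e4, mul_div_cancel_right₀ _ (hv0 _ _ _), mul_div_cancel_right₀ _ (hv0 _ _ _)]
      rw [show v (n + 1) (m + 1) r / v n (m + 1) (r + α) = a n (m + 1) r by
          rw [e1, mul_div_cancel_right₀ _ (hv0 _ _ _)],
        show v (n + 1) (m + 1) r / v (n + 1) m (r + β) = b (n + 1) m r by
          rw [e2, mul_div_cancel_right₀ _ (hv0 _ _ _)]]
      linear_combination e⟩ hv1 (fun n m r h => hu3 n m r (by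
        rw [hva, hvb, add_right_comm r (β : ℤ)] at h
        rw [hdiff]
        refine (mul_eq_zero.1 ?_).resolve_right (hv0 n m (r + α + β))
        linear_combination h))
  have hdiv : ∀ (n m r n' m' r' : ℤ), v n m r / v n' m' r' =
      τ n' m' r' * τ n m (r + 1) / (τ n' m' (r' + 1) * τ n m r) := fun n m r n' m' r' => by
    rw [hvτ, hvτ]
    have := hτ0 n m r
    have := hτ0 n' m' r'
    have := hτ0 n' m' (r' + 1)
    field_simp
  have ha1 : ∀ n m r, a n m r =
      τ n m (r + α) * τ (n + 1) m (r + 1) / (τ n m (r + 1 + α) * τ (n + 1) m r) := fun n m r => by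
    rw [add_right_comm r 1, ← hdiv, hva, mul_div_cancel_right₀ _ (hv0 _ _ _)]
  have hb1 : ∀ n m r, b n m r =
      τ n m (r + β) * τ n (m + 1) (r + 1) / (τ n m (r + 1 + β) * τ n (m + 1) r) := fun n m r => by
    rw [add_right_comm r 1, ← hdiv, hvb, mul_div_cancel_right₀ _ (hv0 _ _ _)]
  refine ⟨τ, hτ0, hτ, fun n m r => ⟨by rw [ha, ha1], by rw [hb, hb1], ?_⟩⟩
  rw [hdiff, ha1, hb1]
  exact (bilinearAt_iff_uRelation hτ0).1 (hτ.2 n m r)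

theorem uHasBilinearForm (N α β : ℕ) {p₁ p₂ : ℂ} (hp₁ : p₁ ≠ 0) (hp₂ : p₂ ≠ 0) :
    UHasBilinearForm N α β p₁ p₂ :=
  ⟨fun _ h0 hper => ⟨⟨exists_uTransform_of_bilinear h0,
      fun ⟨_, _, hu⟩ => ⟨hper, bilinear_of_uTransform h0 hu⟩⟩,
      fun _ hu hT => uSystem_of_uTransform hp₁ hp₂ h0 hu hT⟩,
    fun hp _ hu h1 h2 h3 => exists_tau_of_uSystem hp₁ hp₂ hp hu h1 h2 h3⟩

/-! ### The Hirota–Miwa equation for Cauchy-type determinants -/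

section Determinants

open Matrix

variable {ι R : Type*} [Fintype ι] [DecidableEq ι] [CommRing R] [Algebra ℂ R]

/-- Expansion of a determinant `det (1 + diag c * Z)` in principal minors of `Z`. -/
theorem det_one_add_smul_rows (Z : Matrix ι ι ℂ) (c : ι → R) :
    det (1 + of fun a b => Z a b • c a) =
      ∑ S : Finset ι, (Z.submatrix (Subtype.val : S → ι) Subtype.val).det • ∏ a ∈ S, c a := by
  -- By multilinearity each row is chosen either from the perturbation (a in S) or from the unit
  -- matrix.
  refine (congrArg det (add_comm _ _)).trans (Eq.trans
    ((detRowAlternating (n := ι) (R := R)).toMultilinearMap.map_add_univ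
    (fun a b => Z a b • c a) (fun a b => (1 : Matrix ι ι R) a b))
    (Finset.sum_congr rfl fun S _ => ?_))
  rw [← det_piecewise_one_eq_submatrix_det]
  have e : (S.piecewise (fun a b => Z a b • c a) fun a b => (1 : Matrix ι ι R) a b) =
      of fun a b => (if a ∈ S then c a else 1) *
        (algebraMap ℂ R).mapMatrix (of (S.piecewise Z.row (1 : Matrix ι ι ℂ).row)) a b := by
    funext a b
    by_cases ha : a ∈ S
    · simp [ha, Algebra.smul_def, mul_comm]
    · simp [ha, Matrix.one_apply, apply_ite (algebraMap ℂ R)]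
  rw [e]
  refine (det_mul_column _ _).trans ?_
  rw [Finset.prod_ite_mem, Finset.univ_inter, Algebra.smul_def, mul_comm, RingHom.map_det]

theorem det_eq_of_diagonal_conj {X Y : Matrix ι ι R} {d : ι → ℂ} (hd : ∀ a, d a ≠ 0)
    (h : ∀ a b, d b • X a b = d a • Y a b) : X.det = Y.det := by
  have e : X * diagonal (fun a => algebraMap ℂ R (d a)) =
      diagonal (fun a => algebraMap ℂ R (d a)) * Y := by
    ext a b
    rw [mul_diagonal, diagonal_mul, mul_comm, ← Algebra.smul_def, ← Algebra.smul_def, h]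
  have e1 := congrArg det e
  rw [det_mul, det_mul, det_diagonal, mul_comm, ← map_prod] at e1
  have hu : IsUnit (algebraMap ℂ R (∏ a, d a)) :=
    (Ne.isUnit (Finset.prod_ne_zero_iff.2 fun a _ => hd a)).map _
  exact hu.mul_left_cancel e1

/-- The determinant of `1 + diag c * diag w * (1 / (k b - k' a))`. -/
def cauchyTau (k k' : ι → ℂ) (c : ι → R) (w : ι → ℂ) : R :=
  det (1 + of fun a b => (w a / (k b - k' a)) • c a)

variable {k k' : ι → ℂ} {c : ι → R}

/-- The contraction of the resolvent of the Cauchy matrix with a row vector and the column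
`c a / (q + k' a)`. -/
def cauchyRes (k k' : ι → ℂ) (c : ι → R) (e : ι → R) (q : ℂ) : R :=
  e ⬝ᵥ ((1 + of fun a b => (1 / (k b - k' a)) • c a : Matrix ι ι R)⁻¹ *ᵥ
    fun a => (1 / (q + k' a)) • c a)

/-- Since q + k_b = (q + k'_a) + (k_b - k'_a), conjugation by diag (q + k) turns the shifted matrix
into the unshifted one plus a rank one matrix; the matrix determinant lemma does the rest. -/
theorem cauchyTau_shift (hk : ∀ a b, k b ≠ k' a) {q : ℂ} (hq : ∀ a, q + k a ≠ 0)
    (hq' : ∀ a, q + k' a ≠ 0) (hM : IsUnit (cauchyTau k k' c fun _ => 1)) :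
    cauchyTau k k' c (fun a => (q + k a) / (q + k' a)) = cauchyTau k k' c (fun _ => 1) *
      (1 + cauchyRes k k' c (fun _ => 1) q) := by
  let U : Matrix ι Unit R := of fun a _ => (1 / (q + k' a)) • c a
  let V : Matrix Unit ι R := of fun _ _ => 1
  have h := det_add_mul U V hM
  rw [cauchyTau, det_eq_of_diagonal_conj hq fun a b => ?_, h]
  · congr 1
    rw [det_unique, Matrix.add_apply, one_apply_eq, Matrix.mul_assoc]
    rfl
  · have h1 := sub_ne_zero.2 (hk a b)
    have h2 := hq' a
    have e : (q + k b) * ((q + k a) / (q + k' a) / (k b - k' a)) =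
        (q + k a) * (1 / (k b - k' a) + 1 / (q + k' a)) := by
      field_simp
      ring
    simp only [Matrix.add_apply, of_apply, mul_apply, U, V, Finset.univ_unique,
      Finset.sum_singleton, mul_one]
    rw [add_assoc, ← add_smul, smul_add, smul_add, smul_smul, smul_smul, e]
    rcases eq_or_ne a b with rfl | hab
    · rfl
    · simp [one_apply_ne hab]

/-- Conjugation by diag ((q₁ + k)(q₂ + k)) and partial fractions in k' give a rank two perturbation.
Its 2 × 2 determinant simplifies to one whose columns each depend on a single parameter q; this is
what makes the Plücker relation available. -/
theorem cauchyTau_shift_shift (hk : ∀ a b, k b ≠ k' a) {q₁ q₂ : ℂ} (hq₁ : ∀ a, q₁ + k a ≠ 0)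
    (hq₁' : ∀ a, q₁ + k' a ≠ 0) (hq₂ : ∀ a, q₂ + k a ≠ 0) (hq₂' : ∀ a, q₂ + k' a ≠ 0)
    (hM : IsUnit (cauchyTau k k' c fun _ => 1)) :
    (q₂ - q₁) • cauchyTau k k' c
        (fun a => (q₁ + k a) / (q₁ + k' a) * ((q₂ + k a) / (q₂ + k' a))) =
      cauchyTau k k' c (fun _ => 1) *
        ((1 + cauchyRes k k' c (fun _ => 1) q₁) *
            (algebraMap ℂ R q₂ - cauchyRes k k' c (fun b => algebraMap ℂ R (k b)) q₂) -
          (1 + cauchyRes k k' c (fun _ => 1) q₂) *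
            (algebraMap ℂ R q₁ - cauchyRes k k' c (fun b => algebraMap ℂ R (k b)) q₁)) := by
  rcases eq_or_ne q₁ q₂ with rfl | hne
  · simp
  have hδ : q₂ - q₁ ≠ 0 := sub_ne_zero.2 hne.symm
  let U : Matrix ι (Fin 2) R := of fun a i =>
    ![((q₂ - q₁)⁻¹ * (1 / (q₁ + k' a))) • c a, (-(q₂ - q₁)⁻¹ * (1 / (q₂ + k' a))) • c a] i
  let V : Matrix (Fin 2) ι R := of fun i b =>
    ![algebraMap ℂ R (q₂ + k b), algebraMap ℂ R (q₁ + k b)] i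
  have h := det_add_mul U V hM
  rw [cauchyTau, det_eq_of_diagonal_conj (fun a => mul_ne_zero (hq₁ a) (hq₂ a)) fun a b => ?_, h]
  · set M : Matrix ι ι R := 1 + of fun a b => ((fun _ => 1 : ι → ℂ) a / (k b - k' a)) • c a with hMdef
    have entry : ∀ (i j : Fin 2) (x y z : ℂ), V i = (fun b => algebraMap ℂ R (x + k b)) →
        (fun a => U a j) = (y • fun a => (1 / (z + k' a)) • c a) →
        (V * M⁻¹ * U) i j = y • (x • cauchyRes k k' c (fun _ => 1) z +
          cauchyRes k k' c (fun b => algebraMap ℂ R (k b)) z) := by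
      intro i j x y z hV hU
      have e1 : (V * M⁻¹ * U) i j = V i ⬝ᵥ (M⁻¹ *ᵥ fun a => U a j) := by
        rw [Matrix.mul_assoc]
        rfl
      have e2 : V i = x • (fun _ => 1 : ι → R) + fun b => algebraMap ℂ R (k b) := by
        rw [hV]
        funext b
        simp [Algebra.smul_def]
      rw [e1, e2, hU, mulVec_smul, dotProduct_smul, add_dotProduct, smul_dotProduct]
      rfl
    have e00 := entry 0 0 q₂ (q₂ - q₁)⁻¹ q₁ rfl (by
      funext a
      simp [U, smul_smul])
    have e01 := entry 0 1 q₂ (-(q₂ - q₁)⁻¹) q₂ rfl (by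
      funext a
      simp [U, smul_smul])
    have e10 := entry 1 0 q₁ (q₂ - q₁)⁻¹ q₁ rfl (by
      funext a
      simp [U, smul_smul])
    have e11 := entry 1 1 q₁ (-(q₂ - q₁)⁻¹) q₂ rfl (by
      funext a
      simp [U, smul_smul])
    rw [det_fin_two]
    simp only [Matrix.add_apply, e00, e01, e10, e11, one_apply_eq, ne_eq, zero_ne_one, one_ne_zero,
      not_false_eq_true, one_apply_ne, zero_add]
    have hi : algebraMap ℂ R (q₂ - q₁)⁻¹ * (algebraMap ℂ R q₂ - algebraMap ℂ R q₁) = 1 := by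
      rw [← map_sub, ← map_mul, inv_mul_cancel₀ hδ, map_one]
    simp only [Algebra.smul_def, map_neg, map_sub]
    generalize algebraMap ℂ R (q₂ - q₁)⁻¹ = s at *
    generalize algebraMap ℂ R q₂ = x at *
    generalize algebraMap ℂ R q₁ = y at *
    generalize cauchyRes k k' c (fun _ => 1) q₁ = a1
    generalize cauchyRes k k' c (fun _ => 1) q₂ = a2
    generalize cauchyRes k k' c (fun b => algebraMap ℂ R (k b)) q₁ = b1
    generalize cauchyRes k k' c (fun b => algebraMap ℂ R (k b)) q₂ = b2
    rw [show cauchyTau k k' c (fun _ => 1) = det M from rfl]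
    generalize det M = d
    linear_combination d * (x * a1 + b1 - y * a2 - b2 + s * (x - y) * (a2 * b1 - a1 * b2) +
      (a2 * b1 - a1 * b2)) * hi
  · have h1 := sub_ne_zero.2 (hk a b)
    have h2 := hq₁' a
    have h3 := hq₂' a
    have e : (q₁ + k b) * (q₂ + k b) *
        ((q₁ + k a) / (q₁ + k' a) * ((q₂ + k a) / (q₂ + k' a)) / (k b - k' a)) =
        (q₁ + k a) * (q₂ + k a) * (1 / (k b - k' a) +
          ((q₂ - q₁)⁻¹ * (1 / (q₁ + k' a)) * (q₂ + k b) +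
            -(q₂ - q₁)⁻¹ * (1 / (q₂ + k' a)) * (q₁ + k b))) := by
      field_simp
      ring
    simp only [Matrix.add_apply, of_apply, mul_apply, U, V, Fin.sum_univ_two, cons_val_zero,
      cons_val_one, mul_comm _ (algebraMap ℂ R _), ← Algebra.smul_def, smul_smul]
    rw [add_assoc, ← add_smul, ← add_smul, smul_add, smul_add, smul_smul, smul_smul,
      mul_comm (q₂ + k b) (_ * _), mul_comm (q₁ + k b) (_ * _), e]
    rcases eq_or_ne a b with rfl | hab
    · rfl
    · simp [one_apply_ne hab]

/-- The Hirota–Miwa equation. -/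
theorem cauchyTau_hirota_miwa (hk : ∀ a b, k b ≠ k' a) {q₁ q₂ q₃ : ℂ} (hq₁ : ∀ a, q₁ + k a ≠ 0)
    (hq₁' : ∀ a, q₁ + k' a ≠ 0) (hq₂ : ∀ a, q₂ + k a ≠ 0) (hq₂' : ∀ a, q₂ + k' a ≠ 0)
    (hq₃ : ∀ a, q₃ + k a ≠ 0) (hq₃' : ∀ a, q₃ + k' a ≠ 0)
    (hM : IsUnit (cauchyTau k k' c fun _ => 1)) :
    (q₂ - q₁) • (cauchyTau k k' c (fun a => (q₃ + k a) / (q₃ + k' a)) * cauchyTau k k' c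
        (fun a => (q₁ + k a) / (q₁ + k' a) * ((q₂ + k a) / (q₂ + k' a)))) +
      (q₃ - q₂) • (cauchyTau k k' c (fun a => (q₁ + k a) / (q₁ + k' a)) * cauchyTau k k' c
        (fun a => (q₂ + k a) / (q₂ + k' a) * ((q₃ + k a) / (q₃ + k' a)))) =
      (q₃ - q₁) • (cauchyTau k k' c (fun a => (q₂ + k a) / (q₂ + k' a)) * cauchyTau k k' c
        (fun a => (q₁ + k a) / (q₁ + k' a) * ((q₃ + k a) / (q₃ + k' a)))) := by
  simp only [← mul_smul_comm]
  -- With x_i = 1 + (first contraction) and y_i = q_i - (second contraction), what remains is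
  -- x₃(x₁y₂ - x₂y₁) + x₁(x₂y₃ - x₃y₂) = x₂(x₁y₃ - x₃y₁).
  rw [cauchyTau_shift_shift hk hq₁ hq₁' hq₂ hq₂' hM, cauchyTau_shift_shift hk hq₂ hq₂' hq₃ hq₃' hM,
    cauchyTau_shift_shift hk hq₁ hq₁' hq₃ hq₃' hM, cauchyTau_shift hk hq₁ hq₁' hM,
    cauchyTau_shift hk hq₂ hq₂' hM, cauchyTau_shift hk hq₃ hq₃' hM]
  ring

end Determinants

/-! ### Extraction of the multilinear part: identities for complementary minors -/

section Minors

open Matrix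

variable {ι : Type*} [Fintype ι] [DecidableEq ι]

/-- The multilinear coefficient of a product of two determinants. -/
theorem coeff_det_mul_det (Y Z : Matrix ι ι ℂ) :
    MvPowerSeries.coeff (Finsupp.equivFunOnFinite.symm fun _ : ι => 1)
      (det (1 + of fun a b => Y a b • (MvPowerSeries.X a : MvPowerSeries ι ℂ)) *
        det (1 + of fun a b => Z a b • (MvPowerSeries.X a : MvPowerSeries ι ℂ))) =
    ∑ S : Finset ι, (Y.submatrix (Subtype.val : S → ι) Subtype.val).det *
      (Z.submatrix (Subtype.val : ↥Sᶜ → ι) Subtype.val).det := by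
  rw [det_one_add_smul_rows, det_one_add_smul_rows, Finset.sum_mul_sum, map_sum]
  refine Finset.sum_congr rfl fun S _ => ?_
  have hmon : ∀ S : Finset ι, ∏ a ∈ S, (MvPowerSeries.X a : MvPowerSeries ι ℂ) =
      MvPowerSeries.monomial (Finsupp.equivFunOnFinite.symm fun a => if a ∈ S then 1 else 0) 1 := by
    intro S
    induction S using Finset.induction_on with
    | empty =>
      rw [Finset.prod_empty, ← MvPowerSeries.monomial_zero_one]
      refine congrArg (fun e => MvPowerSeries.monomial e (1 : ℂ)) ?_
      ext
      simp
    | insert a S ha ih =>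
      rw [Finset.prod_insert ha, ih, MvPowerSeries.X, MvPowerSeries.monomial_mul_monomial, one_mul]
      refine congrArg (fun e => MvPowerSeries.monomial e (1 : ℂ)) ?_
      ext b
      by_cases hb : b = a
      · subst hb
        simp [ha]
      · simp [hb]
  -- Each variable has to occur exactly once, so the second subset is the complement of the first.
  rw [map_sum, Finset.sum_eq_single Sᶜ]
  · rw [smul_mul_smul_comm, hmon, hmon, MvPowerSeries.monomial_mul_monomial, one_mul,
      MvPowerSeries.coeff_smul, MvPowerSeries.coeff_monomial, if_pos, mul_one]
    ext a
    by_cases ha : a ∈ S <;> simp [ha]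
  · intro T _ hT
    rw [smul_mul_smul_comm, hmon, hmon, MvPowerSeries.monomial_mul_monomial, one_mul,
      MvPowerSeries.coeff_smul, MvPowerSeries.coeff_monomial, if_neg, mul_zero]
    intro e
    apply hT
    ext a
    have := DFunLike.congr_fun e a
    by_cases ha : a ∈ S <;> by_cases hb : a ∈ T <;> simp [ha, hb] at this ⊢
  · simp

/-- The Hirota–Miwa equation for the principal minors of Cauchy-type matrices. -/
theorem sum_minors_hirota_miwa {k k' : ι → ℂ} (g : ι → ℂ) (hk : ∀ a b, k b ≠ k' a) {q₁ q₂ q₃ : ℂ}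
    (hq₁ : ∀ a, q₁ + k a ≠ 0) (hq₁' : ∀ a, q₁ + k' a ≠ 0) (hq₂ : ∀ a, q₂ + k a ≠ 0)
    (hq₂' : ∀ a, q₂ + k' a ≠ 0) (hq₃ : ∀ a, q₃ + k a ≠ 0) (hq₃' : ∀ a, q₃ + k' a ≠ 0)
    (W : (ι → ℂ) → Finset ι → ℂ)
    (hW : ∀ w S, W w S = det (of fun a b : S => g a * w a / (k b - k' a))) :
    (q₂ - q₁) * ∑ S, W (fun a => (q₃ + k a) / (q₃ + k' a)) S *
        W (fun a => (q₁ + k a) / (q₁ + k' a) * ((q₂ + k a) / (q₂ + k' a))) Sᶜ +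
      (q₃ - q₂) * ∑ S, W (fun a => (q₁ + k a) / (q₁ + k' a)) S *
        W (fun a => (q₂ + k a) / (q₂ + k' a) * ((q₃ + k a) / (q₃ + k' a))) Sᶜ =
      (q₃ - q₁) * ∑ S, W (fun a => (q₂ + k a) / (q₂ + k' a)) S *
        W (fun a => (q₁ + k a) / (q₁ + k' a) * ((q₃ + k a) / (q₃ + k' a))) Sᶜ := by
  -- A formal variable in each row gives the determinant constant term 1, so it is invertible
  -- without any condition on the points, and the coefficient of the product of all variables can be
  -- taken.
  let c : ι → MvPowerSeries ι ℂ := fun a => g a • MvPowerSeries.X a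
  have hT : ∀ w w', MvPowerSeries.coeff (Finsupp.equivFunOnFinite.symm fun _ : ι => 1)
      (cauchyTau k k' c w * cauchyTau k k' c w') = ∑ S, W w S * W w' Sᶜ := by
    intro w w'
    have e : ∀ (w : ι → ℂ) a b, w a / (k b - k' a) * g a = g a * w a / (k b - k' a) :=
      fun w a b => by ring
    simp only [hW, cauchyTau, c, smul_smul, e]
    exact coeff_det_mul_det (of fun a b => g a * w a / (k b - k' a))
      (of fun a b => g a * w' a / (k b - k' a))
  have hM : IsUnit (cauchyTau k k' c fun _ => 1) := by
    rw [MvPowerSeries.isUnit_iff_constantCoeff, cauchyTau, RingHom.map_det]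
    convert isUnit_one
    convert det_one (n := ι) (R := ℂ)
    ext a b
    simp [c, Matrix.one_apply, apply_ite (MvPowerSeries.constantCoeff (σ := ι) (R := ℂ))]
  have h := congrArg (MvPowerSeries.coeff (Finsupp.equivFunOnFinite.symm fun _ : ι => 1))
    (cauchyTau_hirota_miwa hk hq₁ hq₁' hq₂ hq₂' hq₃ hq₃' hM)
  simpa only [map_add, MvPowerSeries.coeff_smul, hT] using h

end Minors

/-! ### Fredholm determinants -/

section Fredholm

open Matrix

variable {X : Type*}

/-- The product of the kernel along a sequence of points. -/
def kerChain (K : X → X → ℂ) (i : ℕ) (x : Fin (i + 1) → X) : ℂ :=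
  ∏ t : Fin i, K (x t.castSucc) (x t.succ)

/-- The product of the kernel along a closed sequence of points. -/
def kerCycle (K : X → X → ℂ) (i : ℕ) (x : Fin (i + 1) → X) : ℂ :=
  kerChain K i x * K (x (Fin.last i)) (x 0)

/-- The determinant of the kernel on a family of points. -/
def kerMinor {ι : Type*} [Fintype ι] [DecidableEq ι] (K : X → X → ℂ) (x : ι → X) : ℂ :=
  det (of fun a b => K (x a) (x b))

/-- The determinant of the kernel on a family of points, bordered by a row and a column. -/
def kerBorder (K : X → X → ℂ) (s : ℕ) (y z : X) (x : Fin s → X) : ℂ :=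
  det (of fun a b : Fin (s + 1) => K (Fin.cons (α := fun _ => X) y x a)
    (Fin.cons (α := fun _ => X) z x b))

/-- A chain closed by a bordered determinant. -/
def kerLoop (K : X → X → ℂ) (i s : ℕ) (z : Fin (i + 1) ⊕ Fin s → X) : ℂ :=
  kerChain K i (z ∘ Sum.inl) *
    kerBorder K s (z (Sum.inl (Fin.last i))) (z (Sum.inl 0)) (z ∘ Sum.inr)

variable (K : X → X → ℂ)

theorem kerBorder_zero (y z : X) (x : Fin 0 → X) : kerBorder K 0 y z x = K y z := by
  simp [kerBorder]

/-- Laplace expansion along the row of y. When the column of x_c is deleted, the row of x_c is moved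
to the top by a cycle of sign (-1)^c. This cancels the Laplace sign up to -1, so that all these
terms carry the same sign. -/
theorem kerBorder_succ (s : ℕ) (y z : X) (x : Fin (s + 1) → X) :
    kerBorder K (s + 1) y z x = K y z * kerMinor K x -
      ∑ c, K y (x c) * kerBorder K s (x c) z (fun a => x (c.succAbove a)) := by
  rw [kerBorder, det_succ_row_zero, Fin.sum_univ_succ, sub_eq_add_neg, ← Finset.sum_neg_distrib]
  congr 1
  · simp only [Fin.val_zero, pow_zero, one_mul, of_apply, Fin.cons_zero, Fin.succAbove_zero]
    rfl
  refine Finset.sum_congr rfl fun c _ => ?_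
  set A : Matrix (Fin (s + 1)) (Fin (s + 1)) ℂ :=
    of fun a b => K (x a) (Fin.cons (α := fun _ => X) z (fun a => x (c.succAbove a)) b)
  have h1 : (of fun a b : Fin (s + 1 + 1) => K (Fin.cons (α := fun _ => X) y x a)
      (Fin.cons (α := fun _ => X) z x b)).submatrix Fin.succ c.succ.succAbove = A := by
    ext a b
    refine Fin.cases ?_ (fun b => ?_) b <;> simp [A]
  have h2 : kerBorder K s (x c) z (fun a => x (c.succAbove a)) =
      det (A.submatrix c.cycleRange.symm id) := by
    rw [kerBorder]
    congr 1
    ext a b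
    refine Fin.cases ?_ (fun a => ?_) a <;> simp [A]
  rw [h1, h2, det_permute, Equiv.Perm.sign_symm, Fin.sign_cycleRange]
  simp only [of_apply, Fin.cons_zero, Fin.cons_succ, Fin.val_succ, pow_succ]
  push_cast
  have : ((-1 : ℂ) ^ (c : ℕ)) * (-1) ^ (c : ℕ) = 1 := by rw [← mul_pow]; simp
  ring

theorem kerMinor_succ (s : ℕ) (x : Fin (s + 1) → X) :
    kerMinor K x = kerBorder K s (x 0) (x 0) (Fin.tail x) := by
  rw [kerMinor, kerBorder, Fin.cons_self_tail]

theorem kerChain_succ (i : ℕ) (x : Fin (i + 1 + 1) → X) :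
    kerChain K (i + 1) x = kerChain K i (x ∘ Fin.castSucc) *
      K (x (Fin.last i).castSucc) (x (Fin.last (i + 1))) := by
  rw [kerChain, Fin.prod_univ_castSucc]
  rfl

theorem kerMinor_comp_equiv {ι κ : Type*} [Fintype ι] [DecidableEq ι] [Fintype κ] [DecidableEq κ]
    (e : ι ≃ κ) (x : κ → X) : kerMinor K (x ∘ e) = kerMinor K x :=
  det_submatrix_equiv_self e (of fun a b => K (x a) (x b))

/-- The relabelling that moves the point `c` of the second family to the end of the first. -/
def loopEquiv (i s : ℕ) (c : Fin (s + 1)) : Fin (i + 1 + 1) ⊕ Fin s ≃ Fin (i + 1) ⊕ Fin (s + 1) :=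
  Equiv.ofBijective
    (Sum.elim (Fin.lastCases (motive := fun _ => Fin (i + 1) ⊕ Fin (s + 1)) (Sum.inr c) Sum.inl)
      fun a => Sum.inr (c.succAbove a)) <| by
    rw [Fintype.bijective_iff_surjective_and_card]
    refine ⟨?_, by simp; omega⟩
    rintro (t | a)
    · exact ⟨Sum.inl t.castSucc, by simp⟩
    · rcases Fin.eq_self_or_eq_succAbove c a with rfl | ⟨b, rfl⟩
      · exact ⟨Sum.inl (Fin.last _), by simp⟩
      · exact ⟨Sum.inr b, rfl⟩

/-- The relabelling that separates the first point. -/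
def headEquiv (s : ℕ) : Fin (0 + 1) ⊕ Fin s ≃ Fin (s + 1) :=
  Equiv.ofBijective (Sum.elim (fun _ => 0) Fin.succ) <| by
    rw [Fintype.bijective_iff_surjective_and_card]
    refine ⟨fun a => ?_, by simp; omega⟩
    refine Fin.cases ⟨Sum.inl 0, rfl⟩ (fun a => ⟨Sum.inr a, rfl⟩) a

theorem kerLoop_zero (i : ℕ) (z : Fin (i + 1) ⊕ Fin 0 → X) :
    kerLoop K i 0 z = kerCycle K i (z ∘ Sum.inl) := by
  rw [kerLoop, kerBorder_zero]
  rfl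

/-- The expansion of the border either closes the chain to a cycle, leaving a full minor, or appends
one further point to the chain. Iteration turns minors into cycles, that is into traces. -/
theorem kerLoop_succ (i s : ℕ) (z : Fin (i + 1) ⊕ Fin (s + 1) → X) :
    kerLoop K i (s + 1) z = kerCycle K i (z ∘ Sum.inl) * kerMinor K (z ∘ Sum.inr) -
      ∑ c, kerLoop K (i + 1) s (z ∘ loopEquiv i s c) := by
  rw [kerLoop, kerBorder_succ, kerCycle, mul_sub, mul_assoc, Finset.mul_sum]
  congr 1
  refine Finset.sum_congr rfl fun c _ => ?_
  rw [kerLoop, kerChain_succ, mul_assoc]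
  have h1 : ((z ∘ loopEquiv i s c) ∘ Sum.inl) ∘ Fin.castSucc = z ∘ Sum.inl := by
    funext t
    simp [loopEquiv]
  have h2 : (z ∘ loopEquiv i s c) (Sum.inl (Fin.last (i + 1))) = z (Sum.inr c) := by
    simp [loopEquiv]
  have h3 : (z ∘ loopEquiv i s c) (Sum.inl 0) = z (Sum.inl 0) := congrFun h1 0
  have h4 : ((z ∘ loopEquiv i s c) ∘ Sum.inl) (Fin.last i).castSucc = z (Sum.inl (Fin.last i)) :=
    congrFun h1 (Fin.last i)
  rw [h1, h4, h3, Function.comp_apply (g := Sum.inl) (x := Fin.last (i + 1)), h2]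
  rfl

theorem kerMinor_eq_kerLoop (s : ℕ) (x : Fin (s + 1) → X) :
    kerMinor K x = kerLoop K 0 s (x ∘ headEquiv s) := by
  rw [kerMinor_succ, kerLoop, kerChain, Finset.univ_eq_empty, Finset.prod_empty, one_mul]
  rfl

end Fredholm

/-! ### Integrated minors: integrability, Newton's recursion, products -/

section FredholmIntegral

variable {X : Type*} [MeasurableSpace X] {ν : Measure X} {K : X → X → ℂ}

variable (ν K) in
/-- The coefficients of the Fredholm determinant. -/
def fredholmCoeff (s : ℕ) : ℂ :=
  (∫ x : Fin s → X, kerMinor K x ∂(Measure.pi fun _ => ν)) / s.factorial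

theorem integral_kerMinor (s : ℕ) :
    ∫ x : Fin s → X, kerMinor K x ∂(Measure.pi fun _ => ν) = s.factorial * fredholmCoeff ν K s := by
  rw [fredholmCoeff, mul_div_cancel₀]
  exact_mod_cast s.factorial_ne_zero

theorem fredholmCoeff_zero : fredholmCoeff ν K 0 = 1 := by
  simp [fredholmCoeff, kerMinor, measureReal_def]

variable (ν) [SigmaFinite ν]

theorem measurePreserving_comp_equiv {ι κ : Type*} [Fintype ι] [Fintype κ] (e : ι ≃ κ) :
    MeasurePreserving (MeasurableEquiv.piCongrLeft (fun _ : ι => X) e.symm)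
      (Measure.pi fun _ : κ => ν) (Measure.pi fun _ : ι => ν) :=
  measurePreserving_piCongrLeft (fun _ => ν) e.symm

theorem piCongrLeft_const_apply {ι κ : Type*} (e : ι ≃ κ) (z : κ → X) :
    MeasurableEquiv.piCongrLeft (fun _ : ι => X) e.symm z = z ∘ e := by
  funext a
  obtain ⟨b, rfl⟩ := e.symm.surjective a
  simp [MeasurableEquiv.coe_piCongrLeft, Equiv.piCongrLeft_apply_apply]

theorem integral_comp_equiv {ι κ : Type*} [Fintype ι] [Fintype κ] (e : ι ≃ κ)
    (f : (ι → X) → ℂ) :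
    ∫ z : κ → X, f (z ∘ e) ∂(Measure.pi fun _ => ν) = ∫ x, f x ∂(Measure.pi fun _ => ν) := by
  rw [← (measurePreserving_comp_equiv ν e).integral_comp']
  simp only [piCongrLeft_const_apply]

theorem integrable_comp_equiv {ι κ : Type*} [Fintype ι] [Fintype κ] (e : ι ≃ κ)
    {f : (ι → X) → ℂ} (hf : Integrable f (Measure.pi fun _ => ν)) :
    Integrable (fun z : κ → X => f (z ∘ e)) (Measure.pi fun _ => ν) := by
  rw [← (measurePreserving_comp_equiv ν e).integrable_comp_emb
    (MeasurableEquiv.measurableEmbedding _)] at hf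
  simpa only [Function.comp_def, piCongrLeft_const_apply] using hf

theorem integral_sum_split {ι κ : Type*} [Fintype ι] [Fintype κ] (f : (ι → X) → ℂ)
    (g : (κ → X) → ℂ) :
    ∫ z : ι ⊕ κ → X, f (z ∘ Sum.inl) * g (z ∘ Sum.inr) ∂(Measure.pi fun _ => ν) =
      (∫ x, f x ∂(Measure.pi fun _ => ν)) * ∫ y, g y ∂(Measure.pi fun _ => ν) := by
  rw [← integral_prod_mul,
    ← (measurePreserving_sumPiEquivProdPi (fun _ : ι ⊕ κ => ν)).integral_comp']
  rfl

theorem integrable_sum_split {ι κ : Type*} [Fintype ι] [Fintype κ] {f : (ι → X) → ℂ}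
    {g : (κ → X) → ℂ} (hf : Integrable f (Measure.pi fun _ => ν))
    (hg : Integrable g (Measure.pi fun _ => ν)) :
    Integrable (fun z : ι ⊕ κ → X => f (z ∘ Sum.inl) * g (z ∘ Sum.inr))
      (Measure.pi fun _ => ν) := by
  have h := hf.mul_prod hg
  rw [← (measurePreserving_sumPiEquivProdPi (fun _ : ι ⊕ κ => ν)).integrable_comp_emb
    (MeasurableEquiv.measurableEmbedding _)] at h
  exact h

variable {ν}

/-- Absolute convergence is known for cyclic products only. The induction treats all chain lengths
at once: a minor of size s + 1 is a loop with s free points, and a loop with s + 1 free points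
reduces to a cycle times a minor and to longer chains with s free points. -/
theorem integrable_kerLoop_kerMinor
    (hK : ∀ i, Integrable (kerCycle K i) (Measure.pi fun _ => ν)) (s : ℕ) :
    (∀ i, Integrable (kerLoop K i s) (Measure.pi fun _ => ν)) ∧
      Integrable (fun x : Fin s → X => kerMinor K x) (Measure.pi fun _ => ν) := by
  induction s with
  | zero =>
    refine ⟨fun i => ?_, ?_⟩
    · simp_rw [funext (kerLoop_zero K i)]
      exact integrable_comp_equiv ν (Equiv.sumEmpty (Fin (i + 1)) (Fin 0)).symm (hK i)
    · simp only [kerMinor, Matrix.det_isEmpty]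
      rw [Measure.pi_of_empty]
      exact integrable_const _
  | succ s ih =>
    have hm : Integrable (fun x : Fin (s + 1) → X => kerMinor K x) (Measure.pi fun _ => ν) := by
      simp_rw [kerMinor_eq_kerLoop]
      exact integrable_comp_equiv ν (headEquiv s) (ih.1 0)
    refine ⟨fun i => ?_, hm⟩
    rw [funext (kerLoop_succ K i s)]
    exact (integrable_sum_split ν (hK i) hm).sub
      (integrable_finsetSum _ fun c _ => integrable_comp_equiv ν (loopEquiv i s c) (ih.1 (i + 1)))

/-- Under the integral the s + 1 points that may be appended to the chain contribute equally, by
symmetry of the product measure; the resulting factors build up s!. -/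
theorem integral_kerLoop (hK : ∀ i, Integrable (kerCycle K i) (Measure.pi fun _ => ν)) (s i : ℕ) :
    ∫ z, kerLoop K i s z ∂(Measure.pi fun _ => ν) = s.factorial * ∑ j ∈ Finset.range (s + 1),
      (-1) ^ j * (∫ x, kerCycle K (i + j) x ∂(Measure.pi fun _ => ν)) *
        fredholmCoeff ν K (s - j) := by
  induction s generalizing i with
  | zero =>
    simp only [kerLoop_zero]
    refine (integral_comp_equiv ν (Equiv.sumEmpty (Fin (i + 1)) (Fin 0)).symm
      (kerCycle K i)).trans ?_
    simp [fredholmCoeff_zero]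
  | succ s ih =>
    have h1 := integrable_sum_split ν (hK i) (integrable_kerLoop_kerMinor hK (s + 1)).2
    have h2 := fun c => integrable_comp_equiv ν (loopEquiv i s c)
      ((integrable_kerLoop_kerMinor hK s).1 (i + 1))
    simp only [kerLoop_succ]
    rw [integral_sub h1 (integrable_finsetSum _ fun c _ => h2 c),
      integral_finsetSum _ fun c _ => h2 c, integral_sum_split, integral_kerMinor]
    simp only [integral_comp_equiv ν _ (kerLoop K (i + 1) s), ih]
    rw [Finset.sum_const, Finset.card_univ, Fintype.card_fin, Finset.sum_range_succ' _ (s + 1),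
      nsmul_eq_mul, Nat.factorial_succ, mul_add, Finset.mul_sum, Finset.mul_sum, Finset.mul_sum,
      sub_eq_neg_add, ← Finset.sum_neg_distrib]
    congr 1
    · refine Finset.sum_congr rfl fun j _ => ?_
      rw [add_right_comm i 1 j, ← add_assoc, Nat.add_sub_add_right]
      push_cast
      ring
    · simp
      ring

/-- The recursion between the coefficients of the Fredholm determinant and the traces. -/
theorem fredholmCoeff_succ (hK : ∀ i, Integrable (kerCycle K i) (Measure.pi fun _ => ν)) (s : ℕ) :
    (s + 1) * fredholmCoeff ν K (s + 1) = ∑ j ∈ Finset.range (s + 1),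
      (-1) ^ j * (∫ x, kerCycle K j x ∂(Measure.pi fun _ => ν)) * fredholmCoeff ν K (s - j) := by
  have h := integral_kerLoop hK s 0
  have h' := integral_comp_equiv ν (headEquiv s) (kerLoop K 0 s)
  simp only [← kerMinor_eq_kerLoop, integral_kerMinor] at h'
  have hs : (s.factorial : ℂ) ≠ 0 := by exact_mod_cast s.factorial_ne_zero
  refine mul_left_cancel₀ hs ?_
  have e : ∀ j, ∫ x, kerCycle K (0 + j) x ∂(Measure.pi fun _ => ν) =
      ∫ x, kerCycle K j x ∂(Measure.pi fun _ => ν) := fun j => by rw [zero_add]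
  simp only [e] at h
  rw [← h, ← h', Nat.factorial_succ]
  push_cast
  ring

theorem integral_kerMinor_of_fintype {ι : Type*} [Fintype ι] [DecidableEq ι] :
    ∫ x : ι → X, kerMinor K x ∂(Measure.pi fun _ => ν) =
      (Fintype.card ι).factorial * fredholmCoeff ν K (Fintype.card ι) := by
  rw [← integral_kerMinor, ← integral_comp_equiv ν (Fintype.equivFin ι)]
  simp only [kerMinor_comp_equiv]

theorem integrable_kerMinor_of_fintype (hK : ∀ i, Integrable (kerCycle K i) (Measure.pi fun _ => ν))
    {ι : Type*} [Fintype ι] [DecidableEq ι] :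
    Integrable (fun x : ι → X => kerMinor K x) (Measure.pi fun _ => ν) := by
  have := integrable_comp_equiv ν (Fintype.equivFin ι).symm
    (integrable_kerLoop_kerMinor hK (Fintype.card ι)).2
  simpa only [kerMinor_comp_equiv] using this

/-- The disjoint union of a finite set and its complement. -/
def complEquiv {ι : Type*} [Fintype ι] [DecidableEq ι] (S : Finset ι) : S ⊕ ↥Sᶜ ≃ ι :=
  Equiv.ofBijective (Sum.elim Subtype.val Subtype.val) <| by
    constructor
    · rintro (⟨a, ha⟩ | ⟨a, ha⟩) (⟨b, hb⟩ | ⟨b, hb⟩) h <;> cases h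
      · rfl
      · exact absurd ha (Finset.mem_compl.1 hb)
      · exact absurd hb (Finset.mem_compl.1 ha)
      · rfl
    · intro a
      by_cases ha : a ∈ S
      · exact ⟨Sum.inl ⟨a, ha⟩, rfl⟩
      · exact ⟨Sum.inr ⟨a, by simpa using ha⟩, rfl⟩

variable {K' : X → X → ℂ}

/-- The two minors involve disjoint sets of variables, so the integral factorizes and depends on S
only through its cardinality. -/
theorem integral_kerMinor_mul_compl (s : ℕ) (S : Finset (Fin s)) :
    ∫ x : Fin s → X, kerMinor K (fun a : S => x a) * kerMinor K' (fun a : ↥Sᶜ => x a)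
      ∂(Measure.pi fun _ => ν) = (S.card.factorial * fredholmCoeff ν K S.card) *
        ((s - S.card).factorial * fredholmCoeff ν K' (s - S.card)) := by
  have h := integral_comp_equiv ν (complEquiv S) fun z =>
    kerMinor K (z ∘ Sum.inl) * kerMinor K' (z ∘ Sum.inr)
  rw [integral_sum_split ν (kerMinor K) (kerMinor K'), integral_kerMinor_of_fintype,
    integral_kerMinor_of_fintype, Fintype.card_coe, Fintype.card_coe, Finset.card_compl,
    Fintype.card_fin] at h
  exact h

theorem integrable_kerMinor_mul_compl
    (hK : ∀ i, Integrable (kerCycle K i) (Measure.pi fun _ => ν))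
    (hK' : ∀ i, Integrable (kerCycle K' i) (Measure.pi fun _ => ν)) (s : ℕ) (S : Finset (Fin s)) :
    Integrable (fun x : Fin s → X => kerMinor K (fun a : S => x a) *
      kerMinor K' (fun a : ↥Sᶜ => x a)) (Measure.pi fun _ => ν) :=
  integrable_comp_equiv ν (complEquiv S) (integrable_sum_split ν
    (integrable_kerMinor_of_fintype hK (ι := S)) (integrable_kerMinor_of_fintype hK' (ι := ↥Sᶜ)))

/-- The coefficients of a product of two Fredholm determinants. -/
theorem sum_antidiagonal_fredholmCoeff
    (hK : ∀ i, Integrable (kerCycle K i) (Measure.pi fun _ => ν))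
    (hK' : ∀ i, Integrable (kerCycle K' i) (Measure.pi fun _ => ν)) (s : ℕ) :
    ∑ p ∈ Finset.HasAntidiagonal.antidiagonal s, fredholmCoeff ν K p.1 * fredholmCoeff ν K' p.2 =
      (∫ x : Fin s → X, ∑ S : Finset (Fin s), kerMinor K (fun a : S => x a) *
        kerMinor K' (fun a : ↥Sᶜ => x a) ∂(Measure.pi fun _ => ν)) / s.factorial := by
  have hs : (s.factorial : ℂ) ≠ 0 := by exact_mod_cast s.factorial_ne_zero
  rw [integral_finsetSum _ fun S _ => integrable_kerMinor_mul_compl hK hK' s S, eq_div_iff hs]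
  simp only [integral_kerMinor_mul_compl]
  -- The number of subsets of size k is s! / (k! (s - k)!), which cancels the factorials.
  have h := Finset.sum_powerset_apply_card (fun k => ((k.factorial : ℂ) * fredholmCoeff ν K k) *
    ((s - k).factorial * fredholmCoeff ν K' (s - k))) (x := (Finset.univ : Finset (Fin s)))
  rw [Finset.powerset_univ, Finset.card_univ, Fintype.card_fin] at h
  rw [h, Finset.Nat.sum_antidiagonal_eq_sum_range_succ
    (fun a b => fredholmCoeff ν K a * fredholmCoeff ν K' b), Finset.sum_mul]
  refine Finset.sum_congr rfl fun k hk => ?_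
  have hk' : k ≤ s := by simpa [Nat.lt_succ_iff] using hk
  rw [← Nat.choose_mul_factorial_mul_factorial hk']
  simp only [nsmul_eq_mul]
  push_cast
  ring

end FredholmIntegral

/-! ### Products of finite disjoint unions of measure spaces -/

section SumMeasure

variable {Θ Y : Type*} [MeasurableSpace Θ] [MeasurableSingletonClass Θ]
  [MeasurableSpace Y] (m : Θ → Measure Y)

/-- The disjoint union of a family of measures. -/
def disjMeasure : Measure (Θ × Y) := Measure.sum fun j => (m j).map (Prod.mk j)

theorem ae_disjMeasure [Countable Θ] {p : Θ × Y → Prop} (h : ∀ j, ∀ᵐ k ∂(m j), p (j, k)) :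
    ∀ᵐ x ∂(disjMeasure m), p x := by
  rw [disjMeasure, Measure.ae_sum_iff]
  intro j
  rw [measurableEmbedding_prodMk_left j |>.ae_map_iff]
  exact h j

theorem measurableEmbedding_pairing {ι : Type*} [Fintype ι] (j : ι → Θ) :
    MeasurableEmbedding fun (k : ι → Y) (t : ι) => (j t, k t) :=
  (MeasurableEquiv.arrowProdEquivProdArrow Θ Y ι).symm.measurableEmbedding.comp
    (measurableEmbedding_prodMk_left j)

end SumMeasure

section FiniteSumMeasure

variable {Θ Y : Type*} [Fintype Θ] [MeasurableSpace Θ] [MeasurableSingletonClass Θ]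
  [MeasurableSpace Y] (m : Θ → Measure Y) [∀ j, SigmaFinite (m j)]

instance : SigmaFinite (disjMeasure m) := by
  have : ∀ j, SigmaFinite ((m j).map (Prod.mk j)) := fun j =>
    (measurableEmbedding_prodMk_left j).sigmaFinite_map
  unfold disjMeasure
  infer_instance

/-- On boxes this is the distributive law for a product of sums. It turns the sum over j₀, …, j_i of
separate integrals into one integral over a power of a single space. -/
theorem pi_disjMeasure {ι : Type*} [Fintype ι] [DecidableEq ι] :
    (Measure.pi fun _ : ι => disjMeasure m) =
      ∑ j : ι → Θ, (Measure.pi fun t => m (j t)).map fun k t => (j t, k t) := by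
  refine Measure.pi_eq fun s hs => ?_
  have h1 : ∀ t, disjMeasure m (s t) = ∑ j, m j (Prod.mk j ⁻¹' s t) := by
    intro t
    rw [disjMeasure, Measure.sum_apply _ (hs t), tsum_fintype]
    exact Finset.sum_congr rfl fun j _ => (measurableEmbedding_prodMk_left j).map_apply _ _
  simp only [h1]
  rw [Measure.finsetSum_apply, Finset.prod_univ_sum, Fintype.piFinset_univ]
  refine Finset.sum_congr rfl fun j _ => ?_
  rw [(measurableEmbedding_pairing j).map_apply, ← Measure.pi_pi]
  congr 1

theorem integrable_pi_disjMeasure {ι : Type*} [Fintype ι] [DecidableEq ι] {f : (ι → Θ × Y) → ℂ} :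
    Integrable f (Measure.pi fun _ : ι => disjMeasure m) ↔
      ∀ j : ι → Θ, Integrable (fun k => f fun t => (j t, k t)) (Measure.pi fun t => m (j t)) := by
  rw [pi_disjMeasure, integrable_finsetSum_measure]
  simp only [Finset.mem_univ, true_imp_iff, (measurableEmbedding_pairing _).integrable_map_iff]
  rfl

theorem integral_pi_disjMeasure {ι : Type*} [Fintype ι] [DecidableEq ι] {f : (ι → Θ × Y) → ℂ}
    (hf : Integrable f (Measure.pi fun _ : ι => disjMeasure m)) :
    ∫ x, f x ∂(Measure.pi fun _ : ι => disjMeasure m) =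
      ∑ j : ι → Θ, ∫ k, f (fun t => (j t, k t)) ∂(Measure.pi fun t => m (j t)) := by
  rw [pi_disjMeasure, integrable_finsetSum_measure] at hf
  rw [pi_disjMeasure, integral_finsetSum_measure hf]
  simp only [(measurableEmbedding_pairing _).integral_map]

end FiniteSumMeasure

/-! ### The infinite matrices -/

theorem regSum_of_finite {f : ℕ → ℂ} {d : ℕ} (hf : ∀ i, d ≤ i → f i = 0) :
    regSum f = ∑ i ∈ Finset.range d, f i :=
  (hasRegSum_of_finite hf).regSum_eq

theorem regSum_zero {f : ℕ → ℂ} (hf : ∀ i, f i = 0) : regSum f = 0 := by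
  rw [regSum_of_finite (d := 0) fun i _ => hf i, Finset.sum_range_zero]

theorem regSum_single {f : ℕ → ℂ} (i₀ : ℕ) (hf : ∀ i, i ≠ i₀ → f i = 0) : regSum f = f i₀ := by
  rw [regSum_of_finite (d := i₀ + 1) fun i hi => hf i (by omega)]
  exact Finset.sum_eq_single i₀ (fun i _ hi => hf i hi) (by simp)

theorem regSumInt_single {f : ℤ → ℂ} (c₀ : ℤ) (hf : ∀ c, c ≠ c₀ → f c = 0) :
    regSumInt f = f c₀ := by
  rcases le_or_gt 0 c₀ with h | h
  · lift c₀ to ℕ using h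
    rw [regSumInt, regSum_single c₀ fun i hi => hf i (by omega), regSum_zero fun i => hf _ (by omega),
      add_zero]
  · obtain ⟨i₀, rfl⟩ : ∃ i₀ : ℕ, c₀ = -(i₀ : ℤ) - 1 := ⟨(-c₀ - 1).toNat, by omega⟩
    rw [regSumInt, regSum_zero fun i => hf _ (by omega),
      regSum_single (f := fun i : ℕ => f (-(i : ℤ) - 1)) i₀ fun i hi => hf _ (by omega), zero_add]

theorem regSumInt_geometric {f : ℤ → ℂ} {A q : ℂ} (hq : q ≠ 1) (hneg : ∀ c < 0, f c = 0)
    (hpos : ∀ i : ℕ, f i = A * q ^ i) : regSumInt f = A / (1 - q) := by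
  rw [regSumInt, regSum_zero (f := fun i : ℕ => f (-(i : ℤ) - 1)) fun i => hneg _ (by omega),
    add_zero, funext hpos]
  exact (hasRegSum_geometric A q hq).regSum_eq

theorem pow_tLam (i : ℕ) (a b : ℤ) : InfMat.pow tLam i a b = if a = b + i then 1 else 0 := by
  induction i generalizing a b with
  | zero => simp [InfMat.pow, InfMat.one]
  | succ i ih =>
    rw [InfMat.pow, InfMat.mul, regSumInt_single (b + 1) fun c hc => by simp [tLam, hc], ih]
    simp only [tLam, if_true, mul_one]
    congr 1
    push_cast
    rw [add_assoc, add_comm (1 : ℤ)]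

/-- The i-th summand ᵗΛ^i O Λ^{-i-1} has its only nonzero entry at (i, -i - 1), so at each position
the series has at most one nonzero term. -/
theorem matOmega_apply (a b : ℤ) : matOmega a b = if 0 ≤ a ∧ b = -a - 1 then 1 else 0 := by
  have h : ∀ i : ℕ, InfMat.mul (InfMat.mul (InfMat.pow tLam i) matO) (InfMat.pow tLam (i + 1)) a b =
      if a = i ∧ b = -a - 1 then 1 else 0 := by
    intro i
    have h1 : ∀ c, InfMat.mul (InfMat.pow tLam i) matO a c = if a = i ∧ 0 = c then 1 else 0 := by
      intro c
      rw [InfMat.mul, regSumInt_single 0 fun d hd => by simp [matO, hd], pow_tLam]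
      simp only [matO, zero_add, true_and, ite_and]
      split_ifs <;> simp
    rw [InfMat.mul, regSumInt_single 0 fun c hc => by simp [h1, hc.symm], h1, pow_tLam]
    by_cases ha : a = i
    · subst ha
      simp only [true_and, if_true, one_mul]
      congr 1
      push_cast
      apply propext
      constructor <;> intro h <;> linarith
    · simp [ha]
  rw [matOmega, funext h]
  by_cases ha : 0 ≤ a
  · lift a to ℕ using ha
    rw [regSum_single a fun i hi => by simp [hi.symm]]
    simp
  · rw [regSum_zero fun i => if_neg fun hi => ha (by omega), if_neg fun hi => ha hi.1]

theorem matOmega_mul (M : InfMat) (a b : ℤ) :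
    InfMat.mul matOmega M a b = if 0 ≤ a then M (-a - 1) b else 0 := by
  rw [InfMat.mul, regSumInt_single (-a - 1) fun c hc => by simp [matOmega_apply, hc], matOmega_apply]
  split_ifs <;> simp_all

/-- The product of rank one matrices. -/
theorem prod_rank_one (i : ℕ) (u k k' : Fin (i + 1) → ℂ) (hk : ∀ t, k t ≠ 0)
    (hkk' : ∀ s t, k s ≠ k' t) (M : Fin (i + 1) → InfMat)
    (hM : ∀ t a b, M t a b = if 0 ≤ a then u t * k t ^ (-a - 1) * k' t ^ b else 0) (a b : ℤ) :
    InfMat.prod i M a b = if 0 ≤ a then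
      (∏ t : Fin i, u t.castSucc / (k t.succ - k' t.castSucc)) * u (Fin.last i) *
        k 0 ^ (-a - 1) * k' (Fin.last i) ^ b else 0 := by
  induction i generalizing b with
  | zero =>
    rw [InfMat.prod, hM]
    simp
  | succ i ih =>
    have h := fun c => ih (fun t => u t.castSucc) (fun t => k t.castSucc) (fun t => k' t.castSucc)
      (fun t => hk _) (fun s t => hkk' _ _) (fun t => M t.castSucc) (fun t => hM _) c
    rw [InfMat.prod, InfMat.mul]
    simp only [h, hM]
    by_cases ha : 0 ≤ a
    · set l := k (Fin.last (i + 1))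
      set q := k' (Fin.last i).castSucc
      have hl : l ≠ 0 := hk _
      have hlq : l - q ≠ 0 := sub_ne_zero.2 (hkk' _ _)
      have hq : q / l ≠ 1 := by
        rw [Ne, div_eq_one_iff_eq hl]
        exact (hkk' _ _).symm
      simp only [ha, if_true]
      -- Adjacent factors are joined by the sum over c ≥ 0 of q^c l^{-c-1} = 1 / (l - q), with q
      -- from the row vector on the left and l from the column vector on the right. No inequality
      -- between |q| and |l| is needed, only q ≠ l.
      rw [regSumInt_geometric (q := q / l)
        (A := (∏ t : Fin i, u t.castSucc.castSucc / (k t.succ.castSucc - k' t.castSucc.castSucc)) *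
          u (Fin.last i).castSucc * k 0 ^ (-a - 1) *
          (u (Fin.last (i + 1)) * l⁻¹ * k' (Fin.last (i + 1)) ^ b)) hq
        (fun c hc => by rw [if_neg (not_le.2 hc), mul_zero]) fun c => ?_]
      · rw [Fin.prod_univ_castSucc]
        simp only [Fin.succ_last, Fin.succ_castSucc]
        rw [show k (Fin.last i.succ) - k' (Fin.last i).castSucc = l - q from rfl]
        field_simp
      · rw [if_pos (by positivity), zpow_sub₀ hl, zpow_neg, zpow_one, zpow_natCast, zpow_natCast,
          div_pow, Fin.castSucc_zero]
        field_simp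
    · simp only [ha, if_false, zero_mul]
      rw [regSumInt_single 0 fun _ _ => rfl]

theorem trace_rank_one (i : ℕ) (u k k' : Fin (i + 1) → ℂ) (hk : ∀ t, k t ≠ 0)
    (hkk' : ∀ s t, k s ≠ k' t) (M : Fin (i + 1) → InfMat)
    (hM : ∀ t a b, M t a b = if 0 ≤ a then u t * k t ^ (-a - 1) * k' t ^ b else 0) :
    InfMat.tr (InfMat.prod i M) = (∏ t : Fin i, u t.castSucc / (k t.succ - k' t.castSucc)) *
      (u (Fin.last i) / (k 0 - k' (Fin.last i))) := by
  have hl := hk 0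
  have hlq : k 0 - k' (Fin.last i) ≠ 0 := sub_ne_zero.2 (hkk' _ _)
  have hq : k' (Fin.last i) / k 0 ≠ 1 := by
    rw [Ne, div_eq_one_iff_eq hl]
    exact (hkk' _ _).symm
  simp only [InfMat.tr, prod_rank_one i u k k' hk hkk' M hM]
  rw [regSumInt_geometric (q := k' (Fin.last i) / k 0)
    (A := (∏ t : Fin i, u t.castSucc / (k t.succ - k' t.castSucc)) * u (Fin.last i) * (k 0)⁻¹) hq
    (fun c hc => if_neg (not_le.2 hc)) fun c => ?_]
  · field_simp
  · rw [if_pos (by positivity), zpow_sub₀ hl, zpow_neg, zpow_one, zpow_natCast, zpow_natCast,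
      div_pow]
    field_simp

/-! ### The traces as integrals of cyclic products of a scalar kernel -/

namespace Data

variable (D : Data)

/-- The product of the plane wave factors. -/
def wave (n m r : ℤ) (j : ℕ) (k : ℂ) : ℂ := D.rho n m r k * D.sigma n m r (omega D.N ^ j * k)

/-- The integral kernel of which the tau function is the Fredholm determinant. -/
def kernelFun (n m r : ℤ) (x y : J D.N × ℂ) : ℂ :=
  D.w x.1 x.2 * D.wave n m r x.1 x.2 / (y.2 - omega D.N ^ (x.1 : ℕ) * x.2)

/-- The measure on the disjoint union of the contours. -/
def contourMeasure : Measure (J D.N × ℂ) := disjMeasure fun j : J D.N => (D.μ j).restrict (D.Γ j)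

variable {D} (hD : D.Admissible)
include hD

theorem Admissible.sigmaFinite_restrict (j : J D.N) :
    SigmaFinite ((D.μ j).restrict (D.Γ j)) := by
  have := hD.sigmaFinite j j.2
  infer_instance

theorem Admissible.sigmaFinite_contourMeasure : SigmaFinite D.contourMeasure := by
  have := hD.sigmaFinite_restrict
  unfold contourMeasure
  infer_instance

/-- Products and trace of rank one matrices leave one Cauchy factor between cyclically neighbouring
points. The points must lie on the contours, where k ≠ 0 and the kernel is regular. -/
theorem Admissible.traceIntegrand_eq (n m r : ℤ) (i : ℕ) (j : Fin (i + 1) → J D.N)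
    {k : Fin (i + 1) → ℂ} (hk : ∀ t, k t ∈ D.Γ (j t)) :
    D.traceIntegrand n m r i j k = kerCycle (D.kernelFun n m r) i fun t => (j t, k t) := by
  rw [traceIntegrand, trace_rank_one i (fun t => D.wave n m r (j t) (k t)) k
    (fun t => omega D.N ^ (j t : ℕ) * k t) (fun t => (hD.regular _ (j t).2 _ (hk t)).1)
    (fun s t => hD.kernel _ (j t).2 _ (hk t) _ (j s).2 _ (hk s)) _ fun t a b => ?_]
  · rw [kerCycle, kerChain, Fin.prod_univ_castSucc]
    simp only [kernelFun, mul_div_assoc, Finset.prod_mul_distrib]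
    ring
  · rw [matOmega_mul]
    simp only [densC, vecC, wave]
    split_ifs <;> ring

theorem Admissible.ae_mem (s : Type*) [Fintype s] (j : s → J D.N) :
    ∀ᵐ k ∂(Measure.pi fun t => (D.μ (j t)).restrict (D.Γ (j t))), ∀ t, k t ∈ D.Γ (j t) := by
  have := hD.sigmaFinite_restrict
  rw [ae_all_iff]
  intro t
  exact (Measure.tendsto_eval_ae_ae (μ := fun t => (D.μ (j t)).restrict (D.Γ (j t)))
    (i := t)).eventually (ae_restrict_mem (hD.measurableSet _ (j t).2))

theorem Admissible.ae_contour (s : Type*) [Fintype s] :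
    ∀ᵐ x ∂(Measure.pi fun _ : s => D.contourMeasure), ∀ t, (x t).2 ∈ D.Γ (x t).1 := by
  have := hD.sigmaFinite_contourMeasure
  rw [ae_all_iff]
  intro t
  refine (Measure.tendsto_eval_ae_ae (μ := fun _ : s => D.contourMeasure)
    (i := t)).eventually (p := fun x => x.2 ∈ D.Γ x.1) (ae_disjMeasure _ fun j => ?_)
  exact ae_restrict_mem (hD.measurableSet _ j.2)

theorem Admissible.integrable_kerCycle (n m r : ℤ) (i : ℕ) :
    Integrable (kerCycle (D.kernelFun n m r) i) (Measure.pi fun _ => D.contourMeasure) := by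
  have := hD.sigmaFinite_restrict
  refine (integrable_pi_disjMeasure _).2 fun j => ?_
  refine (hD.integrable n m r i j).congr ?_
  filter_upwards [hD.ae_mem _ j] with k hk
  exact hD.traceIntegrand_eq n m r i j hk

theorem Admissible.trPow_eq (n m r : ℤ) (i : ℕ) :
    D.trPow n m r i =
      ∫ x, kerCycle (D.kernelFun n m r) i x ∂(Measure.pi fun _ => D.contourMeasure) := by
  have := hD.sigmaFinite_restrict
  rw [contourMeasure, integral_pi_disjMeasure _ (hD.integrable_kerCycle n m r i), trPow]
  refine Finset.sum_congr rfl fun j _ => integral_congr_ae ?_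
  filter_upwards [hD.ae_mem _ j] with k hk
  exact hD.traceIntegrand_eq n m r i j hk

end Data

namespace Data

variable (D : Data)

/-! ### The tau function as a formal power series -/

theorem constantCoeff_logSeries (n m r : ℤ) :
    PowerSeries.constantCoeff (D.logSeries n m r) = 0 := by
  simp [logSeries, ← PowerSeries.coeff_zero_eq_constantCoeff_apply]

theorem coeff_logSeries_pow_of_lt (n m r : ℤ) {s i : ℕ} (h : s < i) :
    PowerSeries.coeff s (D.logSeries n m r ^ i) = 0 := by
  refine PowerSeries.coeff_of_lt_order _ (lt_of_lt_of_le (by exact_mod_cast h)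
    (PowerSeries.le_order_pow_of_constantCoeff_eq_zero i (D.constantCoeff_logSeries n m r)))

theorem coeff_tauSeries (n m r : ℤ) {s d : ℕ} (h : s < d) :
    PowerSeries.coeff s (D.tauSeries n m r) = ∑ i ∈ Finset.range d,
      1 / (i.factorial : ℂ) * PowerSeries.coeff s (D.logSeries n m r ^ i) := by
  rw [tauSeries, PowerSeries.coeff_mk]
  refine Finset.sum_subset (Finset.range_subset_range.2 h) fun i _ hi => ?_
  rw [D.coeff_logSeries_pow_of_lt n m r (by simpa using hi), mul_zero]

theorem coeff_tauSeries_zero (n m r : ℤ) : PowerSeries.coeff 0 (D.tauSeries n m r) = 1 := by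
  simp [tauSeries]

/-- The recursion between the coefficients of the exponential of a series and those of the
series. -/
theorem coeff_tauSeries_succ (n m r : ℤ) (s : ℕ) :
    (s + 1) * PowerSeries.coeff (s + 1) (D.tauSeries n m r) = ∑ j ∈ Finset.range (s + 1),
      ((j + 1) * D.logTerm n m r j) * PowerSeries.coeff (s - j) (D.tauSeries n m r) := by
  set L := D.logSeries n m r with hL
  -- Coefficientwise form of (L^{i+1} / (i+1)!)' = (L^i / i!) L'; summed over i it gives τ' = L' τ.
  have h1 : ∀ i, ((s : ℂ) + 1) * (1 / ((i + 1).factorial : ℂ) *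
      PowerSeries.coeff (s + 1) (L ^ (i + 1))) = 1 / (i.factorial : ℂ) *
        PowerSeries.coeff s (L ^ i * PowerSeries.derivative ℂ L) := by
    intro i
    have e := PowerSeries.coeff_derivative (L ^ (i + 1)) s
    rw [Derivation.leibniz_pow, Nat.add_sub_cancel, smul_eq_mul, map_nsmul,
      nsmul_eq_mul] at e
    have hi : (i.factorial : ℂ) ≠ 0 := by exact_mod_cast i.factorial_ne_zero
    have hi' : (i : ℂ) + 1 ≠ 0 := by exact_mod_cast i.succ_ne_zero
    rw [Nat.factorial_succ]
    push_cast at e ⊢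
    field_simp
    linear_combination -e
  have h2 : ∀ j, PowerSeries.coeff j (PowerSeries.derivative ℂ L) = (j + 1) * D.logTerm n m r j := by
    intro j
    rw [PowerSeries.coeff_derivative]
    simp only [L, logSeries, PowerSeries.coeff_mk, Nat.succ_ne_zero, if_false, Nat.add_sub_cancel]
    ring
  rw [D.coeff_tauSeries n m r (Nat.lt_succ_self (s + 1)), Finset.sum_range_succ',
    mul_add, Finset.mul_sum]
  simp only [← hL, h1, mul_comm (_ ^ _) (PowerSeries.derivative ℂ L), PowerSeries.coeff_mul, h2]
  simp only [pow_zero, PowerSeries.coeff_one, Nat.succ_ne_zero, if_false, mul_zero, add_zero,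
    Finset.mul_sum]
  rw [Finset.sum_comm, Finset.Nat.sum_antidiagonal_eq_sum_range_succ_mk]
  refine Finset.sum_congr rfl fun j _ => ?_
  rw [D.coeff_tauSeries n m r (show s - j < s + 1 by omega), Finset.mul_sum]
  refine Finset.sum_congr rfl fun i _ => ?_
  ring

variable {D}

/-- Both sequences start with 1 and satisfy the same recursion: τ' = L' τ for the exponential,
Newton's recursion for the integrated minors. -/
theorem Admissible.coeff_tauSeries_eq (hD : D.Admissible) (n m r : ℤ) (s : ℕ) :
    PowerSeries.coeff s (D.tauSeries n m r) =
      fredholmCoeff D.contourMeasure (D.kernelFun n m r) s := by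
  have := hD.sigmaFinite_contourMeasure
  induction s using Nat.strong_induction_on with
  | _ s ih =>
    rcases s with _ | s
    · rw [coeff_tauSeries_zero, fredholmCoeff_zero]
    · have hs : (s : ℂ) + 1 ≠ 0 := by exact_mod_cast s.succ_ne_zero
      refine mul_left_cancel₀ hs ?_
      rw [coeff_tauSeries_succ, fredholmCoeff_succ (hD.integrable_kerCycle n m r)]
      refine Finset.sum_congr rfl fun j _ => ?_
      rw [ih (s - j) (by omega), ← hD.trPow_eq, logTerm]
      have hj : (j : ℂ) + 1 ≠ 0 := by exact_mod_cast j.succ_ne_zero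
      field_simp

/-! ### Periodicity -/

theorem omega_pow_N (hN : D.N ≠ 0) : omega D.N ^ D.N = 1 := by
  rw [omega, ← Complex.exp_nat_mul, mul_div_cancel₀ _ (by exact_mod_cast hN), Complex.exp_two_pi_mul_I]

theorem Admissible.omega_pow (hD : D.Admissible) (j : ℕ) : (omega D.N ^ j) ^ D.N = 1 := by
  rw [← pow_mul, mul_comm, pow_mul, omega_pow_N (by have := hD.two_le; omega), one_pow]

theorem omega_pow_mul_ne_zero (j : ℕ) {k : ℂ} (hk : k ≠ 0) :
    omega D.N ^ j * k ≠ 0 :=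
  mul_ne_zero (pow_ne_zero _ (Complex.exp_ne_zero _)) hk

theorem wave_add (n m r n' m' r' : ℤ) (j : ℕ) {k : ℂ} (hk : k ≠ 0) (hk' : omega D.N ^ j * k ≠ 0)
    (h1 : D.p₁ + k ≠ 0) (h2 : D.p₂ + k ≠ 0) (h1' : D.p₁ + omega D.N ^ j * k ≠ 0)
    (h2' : D.p₂ + omega D.N ^ j * k ≠ 0) :
    D.wave (n + n') (m + m') (r + r') j k = D.wave n m r j k * D.wave n' m' r' j k := by
  have hα := mul_ne_zero (pow_ne_zero D.α hk) h1
  have hβ := mul_ne_zero (pow_ne_zero D.β hk) h2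
  have hα' := mul_ne_zero (pow_ne_zero D.α hk') h1'
  have hβ' := mul_ne_zero (pow_ne_zero D.β hk') h2'
  simp only [wave, rho, sigma, neg_add, zpow_add₀ hα, zpow_add₀ hβ, zpow_add₀ hα', zpow_add₀ hβ',
    zpow_add₀ hk, zpow_add₀ hk']
  ring

theorem Admissible.wave_add (hD : D.Admissible) (n m r n' m' r' : ℤ) {j : ℕ} (hj : j ∈ J D.N)
    {k : ℂ} (hk : k ∈ D.Γ j) :
    D.wave (n + n') (m + m') (r + r') j k = D.wave n m r j k * D.wave n' m' r' j k := by
  obtain ⟨h0, h1, h2, h1', h2'⟩ := hD.regular j hj k hk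
  exact Data.wave_add n m r n' m' r' j h0 (omega_pow_mul_ne_zero j h0) h1 h2 h1' h2'

/-- A shift of r by N multiplies ρ σ by k^N / (ω^j k)^N = 1. -/
theorem Admissible.wave_period (hD : D.Admissible) (n m r : ℤ) {j : ℕ} (hj : j ∈ J D.N)
    {k : ℂ} (hk : k ∈ D.Γ j) : D.wave n m (r + D.N) j k = D.wave n m r j k := by
  have h := hD.wave_add n m r 0 0 D.N hj hk
  rw [add_zero, add_zero] at h
  have hk0 : k ^ D.N ≠ 0 := pow_ne_zero _ (hD.regular j hj k hk).1
  rw [h]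
  simp [wave, rho, sigma, mul_pow, hD.omega_pow, hk0]

theorem Admissible.trPow_period (hD : D.Admissible) (n m r : ℤ) (i : ℕ) :
    D.trPow n m (r + D.N) i = D.trPow n m r i := by
  have := hD.sigmaFinite_restrict
  refine Finset.sum_congr rfl fun j _ => integral_congr_ae ?_
  filter_upwards [hD.ae_mem _ j] with k hk
  have e : ∀ t, D.kernelFun n m (r + D.N) (j t, k t) = D.kernelFun n m r (j t, k t) := by
    intro t
    funext y
    simp only [kernelFun, hD.wave_period n m r (j t).2 (hk t)]
  rw [hD.traceIntegrand_eq _ _ _ i j hk, hD.traceIntegrand_eq _ _ _ i j hk]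
  simp only [kerCycle, kerChain, e]

theorem Admissible.logTerm_period (hD : D.Admissible) (n m r : ℤ) :
    D.logTerm n m (r + D.N) = D.logTerm n m r := by
  funext i
  rw [logTerm, logTerm, hD.trPow_period]

theorem Admissible.tauSeries_periodic (hD : D.Admissible) : IsPeriodic D.N D.tauSeries := by
  intro n m r
  simp only [tauSeries, logSeries, hD.logTerm_period]

theorem Admissible.tau_periodic (hD : D.Admissible) : IsPeriodic D.N D.tau := by
  intro n m r
  simp only [tau, hD.logTerm_period]

/-! ### The bilinear equation for the formal power series -/

/-- With k' = ω^j k, a step in n, in m or in r multiplies the plane wave by (q + k)/(q + k') with q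
= p₁, p₂ or 0, once the level is raised by α or β in the first two cases. The six points of (B) thus
carry the six weights of the Hirota–Miwa equation. -/
theorem Admissible.sum_kerMinor_bilinear (hD : D.Admissible) (n m r : ℤ) {s : ℕ}
    {x : Fin s → J D.N × ℂ} (hx : ∀ t, (x t).2 ∈ D.Γ (x t).1) (F : (ℤ × ℤ × ℤ) → (ℤ × ℤ × ℤ) → ℂ)
    (hF : ∀ a b, F a b = ∑ S : Finset (Fin s),
      kerMinor (D.kernelFun a.1 a.2.1 a.2.2) (fun t : S => x t) *
        kerMinor (D.kernelFun b.1 b.2.1 b.2.2) (fun t : ↥Sᶜ => x t)) :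
    (D.p₂ - D.p₁) * F (n, m, r + 1 + D.α + D.β) (n + 1, m + 1, r) -
      D.p₂ * F (n + 1, m, r + D.β) (n, m + 1, r + 1 + D.α) =
    -D.p₁ * F (n, m + 1, r + D.α) (n + 1, m, r + 1 + D.β) := by
  set k : Fin s → ℂ := fun t => (x t).2 with hk
  set k' : Fin s → ℂ := fun t => omega D.N ^ ((x t).1 : ℕ) * (x t).2 with hk'
  have hreg := fun t => hD.regular _ (x t).1.2 _ (hx t)
  have h0 : ∀ t, k t ≠ 0 := fun t => (hreg t).1
  have h0' : ∀ t, k' t ≠ 0 := fun t => omega_pow_mul_ne_zero _ (h0 t)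
  have h1 : ∀ t, D.p₁ + k t ≠ 0 := fun t => (hreg t).2.1
  have h2 : ∀ t, D.p₂ + k t ≠ 0 := fun t => (hreg t).2.2.1
  have h1' : ∀ t, D.p₁ + k' t ≠ 0 := fun t => (hreg t).2.2.2.1
  have h2' : ∀ t, D.p₂ + k' t ≠ 0 := fun t => (hreg t).2.2.2.2
  let e : ℤ → ℤ → ℤ → Fin s → ℂ := fun n m r t => D.wave n m r (x t).1 (x t).2
  have e1 : ∀ n m r t, e (n + 1) m r t = e n m (r + D.α) t * ((D.p₁ + k t) / (D.p₁ + k' t)) := by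
    intro n m r t
    -- The step in n is combined with a change of level by -α, which removes the factors k^α and
    -- k'^α.
    have h := hD.wave_add n m (r + D.α) 1 0 (-D.α) (x t).1.2 (hx t)
    rw [add_zero, add_neg_cancel_right] at h
    refine h.trans (congrArg₂ (· * ·) rfl ?_)
    have := h0 t
    have := h0' t
    simp only [wave, rho, sigma, zpow_neg, neg_neg, zpow_natCast, zpow_one, zpow_zero, neg_zero]
    change (k t ^ D.α * (D.p₁ + k t)) * 1 * (k t ^ D.α)⁻¹ *
      ((k' t ^ D.α * (D.p₁ + k' t))⁻¹ * 1 * k' t ^ D.α) = _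
    field_simp
  have e2 : ∀ n m r t, e n (m + 1) r t = e n m (r + D.β) t * ((D.p₂ + k t) / (D.p₂ + k' t)) := by
    intro n m r t
    have h := hD.wave_add n m (r + D.β) 0 1 (-D.β) (x t).1.2 (hx t)
    rw [add_zero, add_neg_cancel_right] at h
    refine h.trans (congrArg₂ (· * ·) rfl ?_)
    have := h0 t
    have := h0' t
    simp only [wave, rho, sigma, zpow_neg, neg_neg, zpow_natCast, zpow_one, zpow_zero, neg_zero]
    change 1 * (k t ^ D.β * (D.p₂ + k t)) * (k t ^ D.β)⁻¹ *
      (1 * (k' t ^ D.β * (D.p₂ + k' t))⁻¹ * k' t ^ D.β) = _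
    field_simp
  have e3 : ∀ n m r t, e n m (r + 1) t = e n m r t * ((0 + k t) / (0 + k' t)) := by
    intro n m r t
    have h := hD.wave_add n m r 0 0 1 (x t).1.2 (hx t)
    rw [add_zero, add_zero] at h
    refine h.trans (congrArg₂ (· * ·) rfl ?_)
    simp only [wave, rho, sigma, zpow_neg, zpow_one, zpow_zero, neg_zero, zero_add]
    change 1 * 1 * k t * (1 * 1 * (k' t)⁻¹) = _
    ring
  -- The point (n, m, r + α + β) serves as the common origin of all six weights.
  let g : Fin s → ℂ := fun t => D.w (x t).1 (x t).2 * e n m (r + D.α + D.β) t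
  let W : (Fin s → ℂ) → Finset (Fin s) → ℂ := fun w S =>
    Matrix.det (Matrix.of fun a b : S => g a * w a / (k b - k' a))
  have hW : ∀ (a : ℤ × ℤ × ℤ) (w : Fin s → ℂ),
      (∀ t, e a.1 a.2.1 a.2.2 t = e n m (r + D.α + D.β) t * w t) →
      ∀ S : Finset (Fin s),
        kerMinor (D.kernelFun a.1 a.2.1 a.2.2) (fun t : S => x t) = W w S := by
    intro a w ha S
    refine congrArg Matrix.det (Matrix.ext fun t u => ?_)
    change D.w (x t).1 (x t).2 * e a.1 a.2.1 a.2.2 t / (k u - k' t) = g t * w t / (k u - k' t)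
    rw [ha, mul_assoc]
  have key := sum_minors_hirota_miwa (k := k) (k' := k') g
    (fun a b => hD.kernel _ (x a).1.2 _ (hx a) _ (x b).1.2 _ (hx b)) h1 h1' h2 h2'
    (q₃ := 0) (by simpa using h0) (by simpa using h0') W fun _ _ => rfl
  simp only [hF]
  have eA : ∀ t, e n m (r + 1 + D.α + D.β) t =
      e n m (r + D.α + D.β) t * ((0 + k t) / (0 + k' t)) := fun t => by
    rw [show r + 1 + (D.α : ℤ) + D.β = r + D.α + D.β + 1 by ring, e3]
  have eA' : ∀ t, e (n + 1) (m + 1) r t = e n m (r + D.α + D.β) t *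
      ((D.p₁ + k t) / (D.p₁ + k' t) * ((D.p₂ + k t) / (D.p₂ + k' t))) := fun t => by
    rw [e1, e2]
    ring
  have eB : ∀ t, e n (m + 1) (r + D.α) t =
      e n m (r + D.α + D.β) t * ((D.p₂ + k t) / (D.p₂ + k' t)) := fun t => e2 _ _ _ t
  have eB' : ∀ t, e (n + 1) m (r + 1 + D.β) t = e n m (r + D.α + D.β) t *
      ((D.p₁ + k t) / (D.p₁ + k' t) * ((0 + k t) / (0 + k' t))) := fun t => by
    rw [e1, show r + 1 + (D.β : ℤ) + D.α = r + D.α + D.β + 1 by ring, e3]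
    ring
  have eC : ∀ t, e (n + 1) m (r + D.β) t =
      e n m (r + D.α + D.β) t * ((D.p₁ + k t) / (D.p₁ + k' t)) := fun t => by
    rw [e1, add_right_comm]
  have eC' : ∀ t, e n (m + 1) (r + 1 + D.α) t = e n m (r + D.α + D.β) t *
      ((D.p₂ + k t) / (D.p₂ + k' t) * ((0 + k t) / (0 + k' t))) := fun t => by
    rw [e2, show r + 1 + (D.α : ℤ) + D.β = r + D.α + D.β + 1 by ring, e3]
    ring
  simp only [hW (n, m, r + 1 + D.α + D.β) _ eA, hW (n + 1, m + 1, r) _ eA',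
    hW (n, m + 1, r + D.α) _ eB, hW (n + 1, m, r + 1 + D.β) _ eB',
    hW (n + 1, m, r + D.β) _ eC, hW (n, m + 1, r + 1 + D.α) _ eC']
  linear_combination key

theorem Admissible.coeff_tauSeries_mul (hD : D.Admissible) (a b : ℤ × ℤ × ℤ) (s : ℕ) :
    PowerSeries.coeff s (D.tauSeries a.1 a.2.1 a.2.2 * D.tauSeries b.1 b.2.1 b.2.2) =
      (∫ x : Fin s → J D.N × ℂ, ∑ S : Finset (Fin s),
        kerMinor (D.kernelFun a.1 a.2.1 a.2.2) (fun t : S => x t) *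
          kerMinor (D.kernelFun b.1 b.2.1 b.2.2) (fun t : ↥Sᶜ => x t)
        ∂(Measure.pi fun _ => D.contourMeasure)) / s.factorial := by
  have := hD.sigmaFinite_contourMeasure
  rw [PowerSeries.coeff_mul, ← sum_antidiagonal_fredholmCoeff
    (hD.integrable_kerCycle a.1 a.2.1 a.2.2) (hD.integrable_kerCycle b.1 b.2.1 b.2.2)]
  simp only [hD.coeff_tauSeries_eq]

/-- Each coefficient of the products in (B) is an integral over s points on the contours, and the
integrands satisfy the linear relation almost everywhere. -/
theorem Admissible.tauSeries_bilinear (hD : D.Admissible) (n m r : ℤ) :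
    BilinearAt D.α D.β D.p₁ D.p₂ D.tauSeries n m r := by
  have := hD.sigmaFinite_contourMeasure
  ext s
  set F : (Fin s → J D.N × ℂ) → (ℤ × ℤ × ℤ) → (ℤ × ℤ × ℤ) → ℂ := fun x a b =>
    ∑ S : Finset (Fin s), kerMinor (D.kernelFun a.1 a.2.1 a.2.2) (fun t : S => x t) *
        kerMinor (D.kernelFun b.1 b.2.1 b.2.2) (fun t : ↥Sᶜ => x t) with hF
  have hint : ∀ a b, Integrable (fun x => F x a b) (Measure.pi fun _ => D.contourMeasure) :=
    fun a b => integrable_finsetSum _ fun S _ => integrable_kerMinor_mul_compl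
      (hD.integrable_kerCycle _ _ _) (hD.integrable_kerCycle _ _ _) s S
  have hc : ∀ a b : ℤ × ℤ × ℤ,
      PowerSeries.coeff s (D.tauSeries a.1 a.2.1 a.2.2 * D.tauSeries b.1 b.2.1 b.2.2) =
        (∫ x, F x a b ∂(Measure.pi fun _ => D.contourMeasure)) / s.factorial :=
    fun a b => hD.coeff_tauSeries_mul a b s
  have h1 := hc (n, m, r + 1 + D.α + D.β) (n + 1, m + 1, r)
  have h2 := hc (n + 1, m, r + D.β) (n, m + 1, r + 1 + D.α)
  have h3 := hc (n, m + 1, r + D.α) (n + 1, m, r + 1 + D.β)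
  have key : ∫ x, ((D.p₂ - D.p₁) * F x (n, m, r + 1 + D.α + D.β) (n + 1, m + 1, r) -
      D.p₂ * F x (n + 1, m, r + D.β) (n, m + 1, r + 1 + D.α))
        ∂(Measure.pi fun _ => D.contourMeasure) =
      ∫ x, -D.p₁ * F x (n, m + 1, r + D.α) (n + 1, m, r + 1 + D.β)
        ∂(Measure.pi fun _ => D.contourMeasure) := by
    refine integral_congr_ae ?_
    filter_upwards [hD.ae_contour (Fin s)] with x hx
    exact hD.sum_kerMinor_bilinear n m r hx (F x) fun a b => rfl
  rw [integral_sub ((hint _ _).const_mul _) ((hint _ _).const_mul _), integral_const_mul,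
    integral_const_mul, integral_const_mul] at key
  simp only [PowerSeries.coeff_smul, map_sub, smul_eq_mul, h1, h2, h3]
  linear_combination -key / s.factorial

end Data

/-! ### Power series in the unit disc -/

/-- The sum of a formal power series with bounded coefficients in the unit disc. -/
def discSum (φ : ℂ⟦X⟧) (z : ℂ) : ℂ := ∑' s, PowerSeries.coeff s φ * z ^ s

theorem exists_hasFPowerSeriesOnBall_discSum {φ : ℂ⟦X⟧} {C : ℝ}
    (hφ : ∀ s, ‖PowerSeries.coeff s φ‖ ≤ C) :
    HasFPowerSeriesOnBall (discSum φ)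
      (FormalMultilinearSeries.ofScalars ℂ fun s => PowerSeries.coeff s φ) 0 1 := by
  set p := FormalMultilinearSeries.ofScalars ℂ fun s => PowerSeries.coeff s φ with hp
  have hr : (1 : ENNReal) ≤ p.radius := by
    refine p.le_radius_of_bound C (r := 1) fun s => ?_
    rw [NNReal.coe_one, one_pow, mul_one, hp, FormalMultilinearSeries.ofScalars_norm]
    exact hφ s
  have h := (p.hasFPowerSeriesOnBall (lt_of_lt_of_le one_pos hr)).mono one_pos hr
  refine h.congr fun z _ => ?_
  refine (FormalMultilinearSeries.ofScalars_sum_eq _ z).trans ?_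
  rfl

theorem differentiableOn_discSum {φ : ℂ⟦X⟧} {C : ℝ} (hφ : ∀ s, ‖PowerSeries.coeff s φ‖ ≤ C) :
    DifferentiableOn ℂ (discSum φ) (Metric.ball 0 1) := by
  have h := (exists_hasFPowerSeriesOnBall_discSum hφ).differentiableOn
  rwa [← ENNReal.ofReal_one, Metric.eball_ofReal] at h

theorem iteratedDeriv_discSum {φ : ℂ⟦X⟧} {C : ℝ} (hφ : ∀ s, ‖PowerSeries.coeff s φ‖ ≤ C) (s : ℕ) :
    iteratedDeriv s (discSum φ) 0 = s.factorial * PowerSeries.coeff s φ := by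
  have h := (exists_hasFPowerSeriesOnBall_discSum hφ).factorial_smul 1 s
  rw [iteratedDeriv_eq_iteratedFDeriv, ← h, FormalMultilinearSeries.ofScalars_apply_eq]
  simp

/-- The Taylor series of a function holomorphic in the disc converges in the whole disc; no bound on
the coefficients of ψ is required. This is applied to the exponential. -/
theorem hasSum_of_iteratedDeriv {F : ℂ → ℂ} (hF : DifferentiableOn ℂ F (Metric.ball 0 1))
    {ψ : ℂ⟦X⟧} (hψ : ∀ s, iteratedDeriv s F 0 = s.factorial * PowerSeries.coeff s ψ) {z : ℂ}
    (hz : z ∈ Metric.ball (0 : ℂ) 1) : HasSum (fun s => PowerSeries.coeff s ψ * z ^ s) (F z) := by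
  suffices e : (fun s => PowerSeries.coeff s ψ * z ^ s) =
      fun s : ℕ => (s.factorial : ℂ)⁻¹ • (z - 0) ^ s • iteratedDeriv s F 0 from
    e ▸ Complex.hasSum_taylorSeries_on_ball hF hz
  funext s
  have hs : (s.factorial : ℂ) ≠ 0 := by exact_mod_cast s.factorial_ne_zero
  rw [hψ, sub_zero, smul_eq_mul, smul_eq_mul]
  field_simp

theorem hasSum_coeff_mul {φ ψ : ℂ⟦X⟧} {a b z : ℂ}
    (ha : HasSum (fun s => PowerSeries.coeff s φ * z ^ s) a)
    (hb : HasSum (fun s => PowerSeries.coeff s ψ * z ^ s) b) :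
    HasSum (fun s => PowerSeries.coeff s (φ * ψ) * z ^ s) (a * b) := by
  have h := hasSum_sum_range_mul_of_summable_norm ha.summable.norm hb.summable.norm
  rw [ha.tsum_eq, hb.tsum_eq] at h
  refine (congrArg (fun f => HasSum f (a * b)) (funext fun s => ?_)).mp h
  symm
  rw [PowerSeries.coeff_mul, Finset.Nat.sum_antidiagonal_eq_sum_range_succ_mk, Finset.sum_mul]
  refine Finset.sum_congr rfl fun i hi => ?_
  have hi' : i ≤ s := by simpa [Nat.lt_succ_iff] using hi
  rw [show z ^ s = z ^ i * z ^ (s - i) by rw [← pow_add, Nat.add_sub_of_le hi']]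
  ring

/-! ### The tau function as a number: passage from |ε| < 1 to ε = 1 -/

namespace Data

variable {D : Data}

theorem coeff_logSeries_succ (n m r : ℤ) (s : ℕ) :
    PowerSeries.coeff (s + 1) (D.logSeries n m r) = D.logTerm n m r s := by
  simp [logSeries]

theorem tendsto_sum_coeff_logSeries {n m r : ℤ} {L : ℂ} (h : D.LogHasSum n m r L) :
    Tendsto (fun K => ∑ s ∈ Finset.range K, PowerSeries.coeff s (D.logSeries n m r)) atTop (𝓝 L) := by
  -- The term with index i has degree i + 1 in ε, and the coefficient of degree 0 vanishes.
  rw [← tendsto_add_atTop_iff_nat 1]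
  refine h.congr fun K => ?_
  rw [Finset.sum_range_succ']
  simp [coeff_logSeries_succ, D.constantCoeff_logSeries]

theorem LogConverges.bounded {n m r : ℤ} (h : D.LogConverges n m r) :
    ∃ C : ℝ, ∀ s, ‖PowerSeries.coeff s (D.logSeries n m r)‖ ≤ C := by
  obtain ⟨L, hL⟩ := h
  have h1 := tendsto_sum_coeff_logSeries hL
  have h2 := ((tendsto_add_atTop_iff_nat 1).2 h1).sub h1
  simp only [Finset.sum_range_succ_sub_sum] at h2
  obtain ⟨C, hC⟩ := (Metric.isBounded_range_of_tendsto _ h2).exists_norm_le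
  exact ⟨C, fun s => hC _ ⟨s, rfl⟩⟩

/-- Leibniz' rule applied to (exp G)' = G' exp G, with G(0) = 0, reproduces the recursion of the
formal exponential. -/
theorem LogConverges.iteratedDeriv_exp {n m r : ℤ} (h : D.LogConverges n m r) (s : ℕ) :
    iteratedDeriv s (fun z => Complex.exp (discSum (D.logSeries n m r) z)) 0 =
      s.factorial * PowerSeries.coeff s (D.tauSeries n m r) := by
  obtain ⟨C, hC⟩ := h.bounded
  set G := discSum (D.logSeries n m r) with hG
  have hGd : DifferentiableOn ℂ G (Metric.ball 0 1) := differentiableOn_discSum hC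
  have hball : Metric.ball (0 : ℂ) 1 ∈ 𝓝 0 := Metric.ball_mem_nhds _ one_pos
  have hGa : AnalyticAt ℂ G 0 := hGd.analyticAt hball
  induction s using Nat.strong_induction_on with
  | _ s ih =>
    rcases s with _ | s
    · have : G 0 = 0 := by
        have := iteratedDeriv_discSum hC 0
        simpa [D.constantCoeff_logSeries] using this
      simp [this, coeff_tauSeries_zero]
    · have hd : deriv (fun z => Complex.exp (G z)) =ᶠ[𝓝 0]
          (deriv G * fun z => Complex.exp (G z)) := by
        filter_upwards [hball] with z hz
        have := (hGd.differentiableAt (Metric.isOpen_ball.mem_nhds hz)).hasDerivAt.cexp.deriv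
        rw [this, Pi.mul_apply, mul_comm]
      have hE : AnalyticAt ℂ (fun z => Complex.exp (G z)) 0 := hGa.cexp
      rw [iteratedDeriv_succ', hd.iteratedDeriv_eq, iteratedDeriv_mul hGa.deriv.contDiffAt
        hE.contDiffAt, Nat.factorial_succ]
      have e := D.coeff_tauSeries_succ n m r s
      push_cast
      rw [mul_comm ((s : ℂ) + 1), mul_assoc, e, Finset.mul_sum]
      refine Finset.sum_congr rfl fun i hi => ?_
      have hi' : i ≤ s := by simpa [Nat.lt_succ_iff] using hi
      rw [ih (s - i) (by omega), ← iteratedDeriv_succ', iteratedDeriv_discSum hC,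
        coeff_logSeries_succ, ← Nat.choose_mul_factorial_mul_factorial hi', Nat.factorial_succ]
      push_cast
      ring

theorem LogConverges.hasSum_tauSeries {n m r : ℤ} (h : D.LogConverges n m r) {z : ℂ}
    (hz : z ∈ Metric.ball (0 : ℂ) 1) :
    HasSum (fun s => PowerSeries.coeff s (D.tauSeries n m r) * z ^ s)
      (Complex.exp (discSum (D.logSeries n m r) z)) := by
  obtain ⟨C, hC⟩ := h.bounded
  exact hasSum_of_iteratedDeriv (differentiableOn_discSum hC).cexp h.iteratedDeriv_exp hz

theorem LogHasSum.tau_eq {n m r : ℤ} {L : ℂ} (h : D.LogHasSum n m r L) :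
    D.tau n m r = Complex.exp L := by
  rw [tau, h.limUnder_eq, Complex.exp_eq_exp_ℂ, NormedSpace.exp_eq_tsum_div]
  refine tsum_congr fun i => ?_
  rw [one_div, div_eq_mul_inv, mul_comm]

/-- Abel's limit theorem for the logarithm, followed by continuity of exp. The limit is taken
outside the exponential series in ε, whose own convergence at ε = 1 is not assumed. -/
theorem LogConverges.tendsto_exp {n m r : ℤ} (h : D.LogConverges n m r) :
    Tendsto (fun z => Complex.exp (discSum (D.logSeries n m r) z))
      ((𝓝[<] (1 : ℝ)).map Complex.ofReal) (𝓝 (D.tau n m r)) := by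
  obtain ⟨L, hL⟩ := h
  rw [LogHasSum.tau_eq hL]
  exact (Complex.continuous_exp.tendsto L).comp
    (Complex.tendsto_tsum_powerSeries_nhdsWithin_lt (tendsto_sum_coeff_logSeries hL))

/-- For ε in the open disc the coefficient identities sum, through Cauchy products, to (B) for the
six exponentials; both sides then converge as ε increases to 1 along the real axis. -/
theorem Admissible.tau_bilinear (hD : D.Admissible) {n m r : ℤ}
    (hA : D.LogConverges n m (r + 1 + D.α + D.β)) (hA' : D.LogConverges (n + 1) (m + 1) r)
    (hB : D.LogConverges n (m + 1) (r + D.α)) (hB' : D.LogConverges (n + 1) m (r + 1 + D.β))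
    (hC : D.LogConverges (n + 1) m (r + D.β)) (hC' : D.LogConverges n (m + 1) (r + 1 + D.α)) :
    BilinearAt D.α D.β D.p₁ D.p₂ D.tau n m r := by
  have hdisc : ∀ᶠ z in (𝓝[<] (1 : ℝ)).map Complex.ofReal, z ∈ Metric.ball (0 : ℂ) 1 := by
    rw [eventually_map]
    filter_upwards [Ioo_mem_nhdsLT (show (-1 : ℝ) < 1 by norm_num)] with t ht
    rw [mem_ball_zero_iff, Complex.norm_real, Real.norm_eq_abs, abs_lt]
    exact ht
  have hcoeff := fun s => congrArg (PowerSeries.coeff s) (hD.tauSeries_bilinear n m r)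
  simp only [PowerSeries.coeff_smul, map_sub, smul_eq_mul] at hcoeff
  refine tendsto_nhds_unique_of_eventuallyEq
    (((hA.tendsto_exp.mul hA'.tendsto_exp).sub (hB.tendsto_exp.mul hB'.tendsto_exp)).const_smul D.p₁)
    (((hA.tendsto_exp.mul hA'.tendsto_exp).sub (hC.tendsto_exp.mul hC'.tendsto_exp)).const_smul D.p₂)
    ?_
  filter_upwards [hdisc] with z hz
  have h1 := hasSum_coeff_mul (hA.hasSum_tauSeries hz) (hA'.hasSum_tauSeries hz)
  have h2 := hasSum_coeff_mul (hB.hasSum_tauSeries hz) (hB'.hasSum_tauSeries hz)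
  have h3 := hasSum_coeff_mul (hC.hasSum_tauSeries hz) (hC'.hasSum_tauSeries hz)
  refine ((h1.sub h2).const_smul D.p₁).unique ?_
  convert (h1.sub h3).const_smul D.p₂ using 2 with s
  simp only [smul_eq_mul]
  linear_combination z ^ s * hcoeff s

end Data

end FX

end

theorem theorem2 :
    -- both difference systems have the same bilinear form
    (∀ (N α β : ℕ) (p₁ p₂ : ℂ), 2 ≤ N → α < N → β < N → p₁ ≠ 0 → p₂ ≠ 0 →
      FX.UHasBilinearForm N α β p₁ p₂ ∧ FX.VHasBilinearForm N α β p₁ p₂) ∧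
    -- the bilinear system is solved by the tau function
    (∀ D : FX.Data, D.Admissible →
      -- order by order, as a formal expansion
      FX.BilinearSystem D.N D.α D.β D.p₁ D.p₂ D.tauSeries ∧
      -- numerically, wherever the series converge
      FX.IsPeriodic D.N D.tau ∧
      (∀ n m r : ℤ,
        D.LogConverges n m (r + 1 + D.α + D.β) → D.LogConverges (n + 1) (m + 1) r →
        D.LogConverges n (m + 1) (r + D.α) → D.LogConverges (n + 1) m (r + 1 + D.β) →
        D.LogConverges (n + 1) m (r + D.β) → D.LogConverges n (m + 1) (r + 1 + D.α) →
        FX.BilinearAt D.α D.β D.p₁ D.p₂ D.tau n m r)) :=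
  ⟨fun N α β p₁ p₂ _ _ _ hp₁ hp₂ =>
      ⟨FX.uHasBilinearForm N α β hp₁ hp₂, FX.vHasBilinearForm N α β p₁ p₂⟩,
    fun _ hD => ⟨⟨hD.tauSeries_periodic, hD.tauSeries_bilinear⟩, hD.tau_periodic,
      fun _ _ _ hA hA' hB hB' hC hC' => hD.tau_bilinear hA hA' hB hB' hC hC'⟩⟩
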